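/- **Notation.** For $\rho\ge 0$ and a function $u$ on $\mathbb C^n/\mathbb Z^n$ near the closed strip $\{|\mathrm{Im}\,\theta_i|\le\rho,\ i=1,\dots,n\}$ put $\|u\|_\rho=\sup\{|u(\theta)|:\ |\mathrm{Im}\,\theta_i|\le\rho\}$ (for $\rho>0$ and $u$ continuous up to the boundary this is the supremum over the open strip $\mathbb T^n_\rho=\{\theta\in\mathbb C^n/\mathbb Z^n: |\mathrm{Im}\,\theta_i|<\rho\}$; for $\rho=0$ it is the sup norm on the real torus). Let $\hat u_k=\int_{[0,1]^n}u(\theta)e^{-2\pi i k\cdot\theta}\,d\theta$ and $|k|_1=\sum_i|k_i|$ for $k\in\mathbb Z^n$. A vector $\omega\in\mathbb R^n$ is $(\gamma,\tau)$-Diophantine, where $\gamma>0$ and $\tau\ge n$, if $|k\cdot\omega-m|\ge\gamma|k|_1^{-\tau}$ for all $k\in\mathbb Z^n\setminus\{0\}$, $m\in\mathbb Z$. Put $$\mathcal R u(\theta)=\sum_{k\in\mathbb Z^n\setminus\{0\}}\frac{\hat u_k}{1-e^{2\pi i k\cdot\omega}}\,e^{2\pi i k\cdot\theta},\qquad F_{\rho,\delta,\omega}v=\frac{\|\mathcal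 R v\|_{\rho-\delta}}{\|v\|_\rho}.$$ For $L\in\mathbb N=\{0,1,2,\dots\}$ let $$c_R(\delta)=\sqrt{\gamma^2\delta^{2\tau}2^n\sum_{0<|k|_1\le L}\frac{e^{-4\pi|k|_1\delta}}{4|\sin(\pi k\cdot\omega)|^2}+2^{n-3}\zeta(2,2^\tau)(2\pi)^{-2\tau}\int_{4\pi\delta(L+1)}^\infty u^{2\tau}e^{-u}\,du},$$ with $\zeta(a,b)=\sum_{j\ge0}(b+j)^{-a}$. For $N=(N_1,\dots,N_n)$ with integers $N_\ell\ge1$, the discrete Fourier approximation of $u$ is $$\tilde u(\theta)=\sum_{k\in\mathbb Z^n,\ -N_\ell/2\le k_\ell<N_\ell/2}\tilde u_k e^{2\pi i k\cdot\theta},\qquad \tilde u_k=\frac1{N_1\cdots N_n}\sum_{0\le j_\ell<N_\ell}u(\theta_j)e^{-2\pi i k\cdot\theta_j},\quad \theta_j=\Big(\frac{j_1}{N_1},\dots,\frac{j_n}{N_n}\Big).$$ Finally, for $0\le\rho<\tilde\rho$, put $C_N(\rho,\tilde\rho)=S^{*1}_N+S^{*2}_N+T_N$, where $$S^{*1}_N=\prod_{\ell=1}^n\frac1{1-e^{-2\pi\tilde\rho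 N_\ell}}\sum_{\sigma\in\{-1,1\}^n,\ \sigma\ne(1,\dots,1)}\ \prod_{\ell=1}^n e^{(\sigma_\ell-1)\pi\tilde\rho N_\ell}\,\nu_{N_\ell}(\sigma_\ell\tilde\rho-\rho),$$ $$S^{*2}_N=\prod_{\ell=1}^n\frac1{1-e^{-2\pi\tilde\rho N_\ell}}\Big(1-\prod_{\ell=1}^n(1-e^{-2\pi\tilde\rho N_\ell})\Big)\prod_{\ell=1}^n\nu_{N_\ell}(\tilde\rho-\rho),$$ $$T_N=\Big(\frac{e^{2\pi(\tilde\rho-\rho)}+1}{e^{2\pi(\tilde\rho-\rho)}-1}\Big)^n\Big(1-\prod_{\ell=1}^n\big(1-\mu_{N_\ell}(\tilde\rho-\rho)e^{-\pi(\tilde\rho-\rho)N_\ell}\big)\Big),$$ $$\nu_M(\delta)=\frac{e^{2\pi\delta}+1}{e^{2\pi\delta}-1}\big(1-\mu_M(\delta)e^{-\pi\delta M}\big),\qquad \mu_M(\delta)=\begin{cases}1&M\text{ even},\\[2pt] \dfrac{2e^{\pi\delta}}{e^{2\pi\delta}+1}&M\text{ odd}.\end{cases}$$ **Corollary.** Let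 $\omega\in\mathbb R^n$ be $(\gamma,\tau)$-Diophantine with $\gamma>0$, $\tau\ge n$, and let $v:\mathbb T^n_{\hat\rho}\to\mathbb C$ be analytic and not identically zero. Let $L\in\mathbb N$, let $N=(N_1,\dots,N_n)$ with $N_\ell\ge1$, and let $0<\delta\le\rho<\tilde\rho<\hat\rho$. Then the series defining $\mathcal R v$ converges absolutely at every point of the closed strip $|\mathrm{Im}\,\theta_i|\le\rho-\delta$, its sum is bounded there, $\|v\|_\rho>0$, and $$\frac{\|\mathcal R\tilde v\|_{\rho-\delta}-\frac{c_R(\delta)C_N(\rho,\tilde\rho)}{\gamma\delta^\tau}\|v\|_{\tilde\rho}}{\|\tilde v\|_\rho+C_N(\rho,\tilde\rho)\|v\|_{\tilde\rho}}\ \le\ F_{\rho,\delta,\omega}v .$$ If moreover $\|\tilde v\|_\rho-C_N(\rho,\tilde\rho)\|v\|_{\tilde\rho}>0$, then also $$F_{\rho,\delta,\omega}v\ \le\ \frac{\|\mathcal R\tilde v\|_{\rho-\delta}+\frac{c_R(\delta)C_N(\rho,\tilde\rho)}{\gamma\delta^\tau}\|v\|_{\tilde\rho}}{\|\tilde v\|_\rho-C_N(\rho,\tilde\rho)\|v\|_{\tilde\rho}}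 ,$$ so that $F_{\rho,\delta,\omega}v$ lies in the closed interval with these two endpoints. -/

import Mathlib

noncomputable section

namespace CohomEq

variable {n : ℕ}

/-! Functions on `ℂⁿ / ℤⁿ` are modelled as `ℤⁿ`-periodic functions on `Fin n → ℂ`. -/

/-- The open complex strip of width `ρ`: all `θ ∈ ℂⁿ` with `|Im θ_i| < ρ` for every `i`. -/
def strip (n : ℕ) (ρ : ℝ) : Set (Fin n → ℂ) := {θ | ∀ i, |(θ i).im| < ρ}

/-- The closed complex strip of width `ρ`; for `ρ = 0` it is the real space (the real torus,
after passing to the quotient by `ℤⁿ`). -/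
def closedStrip (n : ℕ) (ρ : ℝ) : Set (Fin n → ℂ) := {θ | ∀ i, |(θ i).im| ≤ ρ}

/-- The strip norm `‖u‖_ρ`, the supremum of `|u|` over the strip of width `ρ`, closed so that
`ρ = 0` gives the sup norm on the real torus. For `ρ > 0` and `u` continuous up to the boundary
it is the supremum over the open strip, see `stripNorm_eq_sSup_strip`. -/
def stripNorm (ρ : ℝ) (u : (Fin n → ℂ) → ℂ) : ℝ :=
  sSup ((fun θ => ‖u θ‖) '' closedStrip n ρ)

theorem closure_strip {ρ : ℝ} (hρ : 0 < ρ) : closure (strip n ρ) = closedStrip n ρ := by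
  have h1 : strip n ρ = Set.pi Set.univ (fun _ : Fin n => Complex.im ⁻¹' Set.Ioo (-ρ) ρ) := by
    ext θ
    simp [strip, abs_lt]
  have h2 : closedStrip n ρ
      = Set.pi Set.univ (fun _ : Fin n => Complex.im ⁻¹' Set.Icc (-ρ) ρ) := by
    ext θ
    simp [closedStrip, abs_le]
  have h3 : (-ρ) ≠ ρ := by linarith
  rw [h1, h2, closure_pi_set]
  simp only [Complex.closure_preimage_im, closure_Ioo h3]

theorem stripNorm_eq_sSup_strip {ρ : ℝ} (hρ : 0 < ρ) {u : (Fin n → ℂ) → ℂ}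
    (hu : ContinuousOn u (closedStrip n ρ)) :
    stripNorm ρ u = sSup ((fun θ => ‖u θ‖) '' strip n ρ) := by
  have hc := closure_strip (n := n) hρ
  have hsub : strip n ρ ⊆ closedStrip n ρ := hc ▸ subset_closure
  have himg : (fun θ => ‖u θ‖) '' closedStrip n ρ ⊆
      closure ((fun θ => ‖u θ‖) '' strip n ρ) := by
    rw [← hc] at hu ⊢
    exact hu.norm.image_closure
  have hub : upperBounds ((fun θ => ‖u θ‖) '' closedStrip n ρ) =
      upperBounds ((fun θ => ‖u θ‖) '' strip n ρ) := by
    apply Set.Subset.antisymm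
    · exact upperBounds_mono_set (Set.image_mono hsub)
    · rw [← upperBounds_closure]
      exact upperBounds_mono_set himg
  have hne : (strip n ρ).Nonempty := ⟨0, fun i => by simpa using hρ⟩
  have hne' := hne.mono hsub
  unfold stripNorm
  by_cases hb : BddAbove ((fun θ => ‖u θ‖) '' strip n ρ)
  · have hl := isLUB_csSup (hne.image _) hb
    have : IsLUB ((fun θ => ‖u θ‖) '' closedStrip n ρ)
        (sSup ((fun θ => ‖u θ‖) '' strip n ρ)) := by
      unfold IsLUB at hl ⊢
      rwa [hub]
    exact this.csSup_eq (hne'.image _)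
  · have hb' : ¬ BddAbove ((fun θ => ‖u θ‖) '' closedStrip n ρ) := by
      unfold BddAbove at hb ⊢
      rwa [hub]
    rw [Real.sSup_of_not_bddAbove hb, Real.sSup_of_not_bddAbove hb']

/-- `u` descends to a function on the strip of width `ρ` of `ℂⁿ / ℤⁿ`. -/
def PeriodicOnStrip (ρ : ℝ) (u : (Fin n → ℂ) → ℂ) : Prop :=
  ∀ θ ∈ strip n ρ, ∀ m : Fin n → ℤ, u (fun i => θ i + m i) = u θ

/-- The norm `|k|_1 = ∑ |k_i|`. -/
def l1 (k : Fin n → ℤ) : ℕ := ∑ i, (k i).natAbs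

/-- `(γ, τ)`-Diophantine frequency vectors. -/
def IsDiophantine (γ τ : ℝ) (ω : Fin n → ℝ) : Prop :=
  0 < γ ∧ (n : ℝ) ≤ τ ∧
    ∀ k : Fin n → ℤ, k ≠ 0 → ∀ m : ℤ, γ * (l1 k : ℝ) ^ (-τ) ≤ |∑ i, (k i : ℝ) * ω i - m|

/-- The exponential `e^{2π i k·θ}`. -/
def expo (k : Fin n → ℤ) (θ : Fin n → ℂ) : ℂ :=
  Complex.exp (2 * Real.pi * Complex.I * ∑ i, (k i : ℂ) * θ i)

/-- The Fourier coefficient `û_k = ∫_{[0,1]^n} u(θ) e^{-2π i k·θ} dθ`. -/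
def fourierCoef (u : (Fin n → ℂ) → ℂ) (k : Fin n → ℤ) : ℂ :=
  ∫ θ in Set.Icc (0 : Fin n → ℝ) 1,
    u (fun i => (θ i : ℂ)) *
      Complex.exp (-(2 * Real.pi * Complex.I * ∑ i, (k i : ℂ) * (θ i : ℂ)))

/-- The `k`-th term `v̂_k / (1 - e^{2π i k·ω}) e^{2π i k·θ}` (`0` for `k = 0`) of the zero-average
formal solution of the cohomological equation. -/
def solTerm (ω : Fin n → ℝ) (v : (Fin n → ℂ) → ℂ) (θ : Fin n → ℂ) (k : Fin n → ℤ) : ℂ :=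
  if k = 0 then 0
  else fourierCoef v k / (1 - expo k (fun i => (ω i : ℂ))) * expo k θ

/-- The operator `𝓡`. -/
def solOp (ω : Fin n → ℝ) (v : (Fin n → ℂ) → ℂ) (θ : Fin n → ℂ) : ℂ :=
  ∑' k : Fin n → ℤ, solTerm ω v θ k

/-- The functional `F_{ρ,δ,ω} v = ‖𝓡 v‖_{ρ-δ} / ‖v‖_ρ`. -/
def ratioF (ρ δ : ℝ) (ω : Fin n → ℝ) (v : (Fin n → ℂ) → ℂ) : ℝ :=
  stripNorm (ρ - δ) (solOp ω v) / stripNorm ρ v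

/-- The Hurwitz zeta function `ζ(a,b) = ∑_{j ≥ 0} (b + j)^{-a}`. -/
def hurwitz (a b : ℝ) : ℝ := ∑' j : ℕ, (b + j) ^ (-a)

/-- The multi-indices with `0 < |k|_1 ≤ L`. -/
def smallIndices (n L : ℕ) : Finset (Fin n → ℤ) :=
  (Fintype.piFinset fun _ => Finset.Icc (-(L : ℤ)) L).filter fun k => 0 < l1 k ∧ l1 k ≤ L

theorem mem_smallIndices (L : ℕ) (k : Fin n → ℤ) :
    k ∈ smallIndices n L ↔ 0 < l1 k ∧ l1 k ≤ L := by
  simp only [smallIndices, Finset.mem_filter, Fintype.mem_piFinset, Finset.mem_Icc,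
    and_iff_right_iff_imp]
  rintro ⟨-, h⟩ i
  have : (k i).natAbs ≤ l1 k :=
    Finset.single_le_sum (f := fun i => (k i).natAbs) (fun _ _ => Nat.zero_le _)
      (Finset.mem_univ i)
  omega

/-- The Rüssmann factor `c_R(δ)`, computed with the divisors of order at most `L`. -/
def russmannFactor (L : ℕ) (γ τ : ℝ) (ω : Fin n → ℝ) (δ : ℝ) : ℝ :=
  √(γ ^ 2 * δ ^ (2 * τ) * 2 ^ n *
        ∑ k ∈ smallIndices n L,
          Real.exp (-(4 * Real.pi * l1 k * δ)) /
            (4 * |Real.sin (Real.pi * ∑ i, (k i : ℝ) * ω i)| ^ 2)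
      + (2 : ℝ) ^ ((n : ℤ) - 3) * hurwitz 2 (2 ^ τ) * (2 * Real.pi) ^ (-(2 * τ)) *
        ∫ u in Set.Ioi (4 * Real.pi * δ * (L + 1)), u ^ (2 * τ) * Real.exp (-u))

/-- The discrete Fourier transform `ũ_k` on the regular grid of size `N`. -/
def dftCoef (N : Fin n → ℕ) (u : (Fin n → ℂ) → ℂ) (k : Fin n → ℤ) : ℂ :=
  1 / (∏ i, (N i : ℂ)) *
    ∑ j ∈ Fintype.piFinset fun i => Finset.range (N i),
      u (fun i => (j i : ℂ) / (N i : ℂ)) *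
        Complex.exp (-(2 * Real.pi * Complex.I * ∑ i, (k i : ℂ) * ((j i : ℂ) / (N i : ℂ))))

/-- The multi-indices with `-N_ℓ / 2 ≤ k_ℓ < N_ℓ / 2`. -/
def gridIndices (N : Fin n → ℕ) : Finset (Fin n → ℤ) :=
  Fintype.piFinset fun i =>
    (Finset.Icc (-(N i : ℤ)) (N i)).filter fun a => -(N i : ℤ) ≤ 2 * a ∧ 2 * a < N i

/-- The discrete Fourier approximation `ũ`. -/
def dftApprox (N : Fin n → ℕ) (u : (Fin n → ℂ) → ℂ) (θ : Fin n → ℂ) : ℂ :=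
  ∑ k ∈ gridIndices N, dftCoef N u k * expo k θ

/-- `μ_M(δ)`. -/
def dftMu (M : ℕ) (δ : ℝ) : ℝ :=
  if Even M then 1 else 2 * Real.exp (Real.pi * δ) / (Real.exp (2 * Real.pi * δ) + 1)

/-- `ν_M(δ)`. -/
def dftNu (M : ℕ) (δ : ℝ) : ℝ :=
  (Real.exp (2 * Real.pi * δ) + 1) / (Real.exp (2 * Real.pi * δ) - 1) *
    (1 - dftMu M δ * Real.exp (-(Real.pi * δ * M)))

/-- `S_N^{*1}(ρ, ρ')`. -/
def dftS1 (N : Fin n → ℕ) (ρ ρ' : ℝ) : ℝ :=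
  (∏ i, 1 / (1 - Real.exp (-(2 * Real.pi * ρ' * N i)))) *
    ∑ σ ∈ (Fintype.piFinset fun _ : Fin n => ({-1, 1} : Finset ℤ)).filter fun σ => σ ≠ 1,
      ∏ i, Real.exp (((σ i : ℝ) - 1) * Real.pi * ρ' * N i) * dftNu (N i) ((σ i : ℝ) * ρ' - ρ)

/-- `S_N^{*2}(ρ, ρ')`. -/
def dftS2 (N : Fin n → ℕ) (ρ ρ' : ℝ) : ℝ :=
  (∏ i, 1 / (1 - Real.exp (-(2 * Real.pi * ρ' * N i)))) *
    (1 - ∏ i, (1 - Real.exp (-(2 * Real.pi * ρ' * N i)))) * ∏ i, dftNu (N i) (ρ' - ρ)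

/-- `T_N(ρ, ρ')`. -/
def dftT (N : Fin n → ℕ) (ρ ρ' : ℝ) : ℝ :=
  ((Real.exp (2 * Real.pi * (ρ' - ρ)) + 1) / (Real.exp (2 * Real.pi * (ρ' - ρ)) - 1)) ^ n *
    (1 - ∏ i, (1 - dftMu (N i) (ρ' - ρ) * Real.exp (-(Real.pi * (ρ' - ρ) * N i))))

/-- The DFT error constant `C_N(ρ, ρ')`. -/
def dftConst (N : Fin n → ℕ) (ρ ρ' : ℝ) : ℝ :=
  dftS1 N ρ ρ' + dftS2 N ρ ρ' + dftT N ρ ρ'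

end CohomEq

end

noncomputable section

namespace CohomEq

open MeasureTheory Filter Topology

variable {n : ℕ}

/-! ### Strips -/

/-! Since `solOp` is linear, replacing v by its discrete approximation ṽ changes the denominator of
F by at most ‖v - ṽ‖_ρ and the numerator by at most ‖𝓡(v - ṽ)‖_{ρ-δ}. Two estimates therefore
suffice: the aliasing bound `norm_sub_dftApprox_le` for v - ṽ, and Rüssmann's bound
`IsDiophantine.norm_solOp_le` applied to v - ṽ. The interval follows from triangle inequalities and
monotonicity of quotients.

Both rest on `mean_shift`: moving the real torus to height η multiplies û_k by e^{-2πk·η}. Bessel's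
inequality on the 2^n slices with η = (±ρ, …, ±ρ) then yields the weighted square sum
`sum_sq_fourierCoef_le`, the exponential decay `norm_fourierCoef_le`, and convergence of the Fourier
series on the strip.

Rüssmann's bound is Cauchy–Schwarz between that square sum and a sum of e^{-4π|k|δ} over squared
divisors. Terms with |k| ≤ L are kept as they are. In the tail, each exponential is written as an
integral of e^{-u}, which leaves, at every u, an unweighted divisor sum over |k| < u/(4πδ). There
the Diophantine condition, applied to differences of indices, separates the distances to the nearest
integers, so a Hurwitz zeta value bounds the sum (`sum_divisors_le`).

Aliasing sends the mode l to its representative `reduce N l` in the grid (`hasSum_dftApprox`). Hence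
only off-grid modes contribute to v - ṽ, and `hasSum_dftConst` identifies C_N as the sum of their
bounds, a combination of products of one-dimensional geometric sums. -/

theorem isOpen_strip (R : ℝ) : IsOpen (strip n R) := by
  simp only [strip, Set.ofPred_forall]
  exact isOpen_iInter_of_finite fun i => isOpen_lt (by fun_prop) continuous_const

theorem strip_eq_pi (R : ℝ) :
    strip n R = Set.pi Set.univ (fun _ : Fin n => Complex.im ⁻¹' Set.Ioo (-R) R) := by
  ext θ
  simp [strip, abs_lt]

theorem convex_strip (R : ℝ) : Convex ℝ (strip n R) := by
  rw [strip_eq_pi]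
  exact convex_pi fun i _ => (convex_Ioo _ _).linear_preimage Complex.imLm

theorem closedStrip_subset_strip {ρ R : ℝ} (h : ρ < R) : closedStrip n ρ ⊆ strip n R :=
  fun _ hθ i => (hθ i).trans_lt h

theorem closedStrip_nonempty {ρ : ℝ} (h : 0 ≤ ρ) : (closedStrip n ρ).Nonempty :=
  ⟨0, fun i => by simpa using h⟩

/-- The point `x + i η`. -/
def shift (x η : Fin n → ℝ) : Fin n → ℂ := fun i => (x i : ℂ) + (η i : ℂ) * Complex.I

theorem shift_re_im (θ : Fin n → ℂ) : shift (fun i => (θ i).re) (fun i => (θ i).im) = θ := by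
  ext i
  simp [shift, Complex.re_add_im]

theorem shift_zero (x : Fin n → ℝ) : shift x 0 = fun i => (x i : ℂ) := by
  ext i
  simp [shift]

theorem shift_im (x η : Fin n → ℝ) (i : Fin n) : (shift x η i).im = η i := by simp [shift]

theorem continuous_shift : Continuous fun p : (Fin n → ℝ) × (Fin n → ℝ) => shift p.1 p.2 := by
  unfold shift
  fun_prop

/-- Analytic functions on the strip of width `R` of `ℂⁿ / ℤⁿ`. -/
structure StripAnalytic (R : ℝ) (u : (Fin n → ℂ) → ℂ) : Prop where
  analytic : AnalyticOnNhd ℂ u (strip n R)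
  periodic : PeriodicOnStrip R u

namespace StripAnalytic

variable {R : ℝ} {u w : (Fin n → ℂ) → ℂ}

theorem sub (hu : StripAnalytic R u) (hw : StripAnalytic R w) :
    StripAnalytic R (fun θ => u θ - w θ) :=
  ⟨hu.analytic.sub hw.analytic, fun θ hθ m => by
    simp only [hu.periodic θ hθ m, hw.periodic θ hθ m]⟩

theorem mul (hu : StripAnalytic R u) (hw : StripAnalytic R w) :
    StripAnalytic R (fun θ => u θ * w θ) :=
  ⟨hu.analytic.mul hw.analytic, fun θ hθ m => by
    simp only [hu.periodic θ hθ m, hw.periodic θ hθ m]⟩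

theorem continuousOn (hu : StripAnalytic R u) : ContinuousOn u (strip n R) :=
  hu.analytic.continuousOn

/-- The closed strip is not compact, but periodicity brings real parts into [0,1], and the resulting
box is a compact subset of the open strip. -/
theorem bddAbove (hu : StripAnalytic R u) {ρ : ℝ} (hρ : ρ < R) :
    BddAbove ((fun θ => ‖u θ‖) '' closedStrip n ρ) := by
  set K : Set (Fin n → ℂ) := (fun p : (Fin n → ℝ) × (Fin n → ℝ) => shift p.1 p.2) ''
    (Set.Icc 0 1 ×ˢ Set.Icc (fun _ => -ρ) (fun _ => ρ)) with hK
  have hKc : IsCompact K := (isCompact_Icc.prod isCompact_Icc).image continuous_shift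
  have hKs : K ⊆ strip n R := by
    rintro _ ⟨⟨x, η⟩, ⟨-, h1, h2⟩, rfl⟩ i
    simp only [shift_im]
    exact (abs_le.2 ⟨h1 i, h2 i⟩).trans_lt hρ
  obtain ⟨C, hC⟩ := hKc.bddAbove_image (f := fun θ => ‖u θ‖) (hu.continuousOn.mono hKs).norm
  refine ⟨C, ?_⟩
  rintro _ ⟨θ, hθ, rfl⟩
  have h1 := hu.periodic θ (closedStrip_subset_strip hρ hθ) (fun i => -⌊(θ i).re⌋)
  simp only [← h1]
  refine hC ⟨_, ⟨⟨fun i => Int.fract (θ i).re, fun i => (θ i).im⟩, ⟨⟨?_, ?_⟩, ?_, ?_⟩, ?_⟩, rfl⟩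
  · exact fun i => Int.fract_nonneg _
  · exact fun i => (Int.fract_lt_one _).le
  · exact fun i => (abs_le.1 (hθ i)).1
  · exact fun i => (abs_le.1 (hθ i)).2
  · ext i
    apply Complex.ext <;> simp [shift, Int.fract, sub_eq_add_neg]

theorem norm_le_stripNorm (hu : StripAnalytic R u) {ρ : ℝ} (hρ : ρ < R) {θ : Fin n → ℂ}
    (hθ : θ ∈ closedStrip n ρ) : ‖u θ‖ ≤ stripNorm ρ u :=
  le_csSup (hu.bddAbove hρ) ⟨θ, hθ, rfl⟩

end StripAnalytic

theorem stripNorm_nonneg (ρ : ℝ) (u : (Fin n → ℂ) → ℂ) : 0 ≤ stripNorm ρ u := by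
  apply Real.sSup_nonneg
  rintro _ ⟨θ, -, rfl⟩
  exact norm_nonneg _

theorem stripNorm_le {ρ : ℝ} (hρ : 0 ≤ ρ) {u : (Fin n → ℂ) → ℂ} {C : ℝ}
    (h : ∀ θ ∈ closedStrip n ρ, ‖u θ‖ ≤ C) : stripNorm ρ u ≤ C := by
  apply csSup_le ((closedStrip_nonempty hρ).image _)
  rintro _ ⟨θ, hθ, rfl⟩
  exact h θ hθ

theorem stripAnalytic_finsetSum {ι : Type*} {R : ℝ} (s : Finset ι) {f : ι → (Fin n → ℂ) → ℂ}
    (h : ∀ i ∈ s, StripAnalytic R (f i)) : StripAnalytic R (fun θ => ∑ i ∈ s, f i θ) :=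
  ⟨Finset.analyticOnNhd_fun_sum s fun i hi => (h i hi).analytic,
    fun θ hθ m => Finset.sum_congr rfl fun i hi => (h i hi).periodic θ hθ m⟩

theorem stripAnalytic_const (R : ℝ) (c : ℂ) : StripAnalytic (n := n) R (fun _ => c) :=
  ⟨analyticOnNhd_const, fun _ _ _ => rfl⟩

/-! ### Complex exponentials on the strip. -/

theorem expo_add_int (k : Fin n → ℤ) (θ : Fin n → ℂ) (m : Fin n → ℤ) :
    expo k (fun i => θ i + m i) = expo k θ := by
  unfold expo
  rw [Complex.exp_eq_exp_iff_exists_int]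
  refine ⟨∑ i, k i * m i, ?_⟩
  push_cast
  simp only [mul_add, Finset.sum_add_distrib]
  ring

theorem stripAnalytic_expo (R : ℝ) (k : Fin n → ℤ) : StripAnalytic R (expo k) := by
  refine ⟨?_, fun θ _ m => expo_add_int k θ m⟩
  have h : Differentiable ℂ fun θ : Fin n → ℂ =>
    (2 * Real.pi * Complex.I * ∑ i, (k i : ℂ) * θ i) := by fun_prop
  have h2 : AnalyticOnNhd ℂ (fun θ : Fin n → ℂ =>
      (2 * Real.pi * Complex.I * ∑ i, (k i : ℂ) * θ i)) (strip n R) := by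
    refine AnalyticOnNhd.mul analyticOnNhd_const ?_
    refine Finset.analyticOnNhd_fun_sum _ fun i _ => AnalyticOnNhd.mul analyticOnNhd_const ?_
    exact (ContinuousLinearMap.proj (R := ℂ) (φ := fun _ : Fin n => ℂ) i).analyticOnNhd _
  exact h2.cexp

theorem expo_add (k l : Fin n → ℤ) (θ : Fin n → ℂ) : expo (k + l) θ = expo k θ * expo l θ := by
  simp only [expo, ← Complex.exp_add, Pi.add_apply, ← mul_add, ← Finset.sum_add_distrib]
  congr 3
  ext i
  push_cast
  ring

theorem expo_neg (k : Fin n → ℤ) (θ : Fin n → ℂ) :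
    expo (-k) θ = Complex.exp (-(2 * Real.pi * Complex.I * ∑ i, (k i : ℂ) * θ i)) := by
  simp [expo]

theorem expo_shift (k : Fin n → ℤ) (x η : Fin n → ℝ) :
    expo k (shift x η) = Real.exp (-(2 * Real.pi * ∑ i, (k i : ℝ) * η i)) *
      expo k (fun i => (x i : ℂ)) := by
  simp only [expo, shift, Complex.ofReal_exp, ← Complex.exp_add]
  congr 1
  push_cast
  simp only [mul_add, Finset.sum_add_distrib, ← mul_assoc, ← Finset.sum_mul]
  linear_combination (2 * Real.pi * ∑ i, (k i : ℂ) * η i) * Complex.I_mul_I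

theorem norm_expo_real (k : Fin n → ℤ) (x : Fin n → ℝ) : ‖expo k (fun i => (x i : ℂ))‖ = 1 := by
  have : (2 * Real.pi * Complex.I * ∑ i, (k i : ℂ) * (x i : ℂ)) =
    ((2 * Real.pi * ∑ i, (k i : ℝ) * x i : ℝ) : ℂ) * Complex.I := by push_cast; ring
  rw [expo, this, Complex.norm_exp_ofReal_mul_I]

theorem norm_expo (k : Fin n → ℤ) (θ : Fin n → ℂ) :
    ‖expo k θ‖ = Real.exp (-(2 * Real.pi * ∑ i, (k i : ℝ) * (θ i).im)) := by
  conv_lhs => rw [← shift_re_im θ]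
  rw [expo_shift, norm_mul, norm_expo_real, mul_one, Complex.norm_real, Real.norm_eq_abs,
    Real.abs_exp]

theorem l1_cast (k : Fin n → ℤ) : (l1 k : ℝ) = ∑ i, |(k i : ℝ)| := by
  simp [l1, Nat.cast_natAbs]

theorem norm_expo_le (k : Fin n → ℤ) {ρ : ℝ} {θ : Fin n → ℂ} (hθ : θ ∈ closedStrip n ρ) :
    ‖expo k θ‖ ≤ Real.exp (2 * Real.pi * ρ * l1 k) := by
  rw [norm_expo, Real.exp_le_exp, l1_cast, Finset.mul_sum, Finset.mul_sum, ← Finset.sum_neg_distrib]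
  refine Finset.sum_le_sum fun i _ => ?_
  have h1 : -((k i : ℝ) * (θ i).im) ≤ |(k i : ℝ)| * ρ :=
    (neg_le_abs _).trans (by rw [abs_mul]; gcongr; exact hθ i)
  nlinarith [Real.pi_pos]

/-! ### Periodic functions and the torus -/

/-- The function on the torus induced by a periodic function on `ℝⁿ`. -/
def torusLift (f : (Fin n → ℝ) → ℂ) : UnitAddTorus (Fin n) → ℂ :=
  fun y => f fun i => (AddCircle.equivIoc 1 0 (y i)).1

theorem torusLift_coe {f : (Fin n → ℝ) → ℂ}
    (hf : ∀ x (m : Fin n → ℤ), f (fun i => x i + m i) = f x) (x : Fin n → ℝ) :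
    torusLift f (fun i => (x i : UnitAddCircle)) = f x := by
  have h : ∀ i, ∃ m : ℤ, (AddCircle.equivIoc 1 0 (x i : UnitAddCircle)).1 = x i + m := by
    intro i
    have h1 : (((AddCircle.equivIoc 1 0 (x i : UnitAddCircle)).1 : ℝ) : UnitAddCircle) = x i :=
      (AddCircle.equivIoc 1 0).symm_apply_apply (x i : UnitAddCircle)
    rw [← sub_eq_zero, ← AddCircle.coe_sub, AddCircle.coe_eq_zero_iff] at h1
    obtain ⟨m, hm⟩ := h1
    exact ⟨m, by rw [zsmul_one] at hm; linarith⟩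
  choose m hm using h
  simp only [torusLift, hm]
  exact hf x m

/-- The chosen representative in (0,1] jumps, so continuity is tested after composition with the
open quotient map ℝⁿ → 𝕋ⁿ, where the lift becomes `f` itself. -/
theorem continuous_torusLift {f : (Fin n → ℝ) → ℂ} (hc : Continuous f)
    (hf : ∀ x (m : Fin n → ℤ), f (fun i => x i + m i) = f x) : Continuous (torusLift f) := by
  have hq : IsOpenQuotientMap
      (Pi.map fun (_ : Fin n) (t : ℝ) => (t : UnitAddCircle)) :=
    IsOpenQuotientMap.piMap fun _ => QuotientAddGroup.isOpenQuotientMap_mk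
  rw [hq.isQuotientMap.continuous_iff]
  convert hc using 1
  ext x
  exact torusLift_coe hf x

theorem Ioc_ae_eq_Icc_pi :
    ({x : Fin n → ℝ | ∀ i, x i ∈ Set.Ioc ((0 : Fin n → ℝ) i) ((0 : Fin n → ℝ) i + 1)}
      : Set (Fin n → ℝ)) =ᵐ[volume] Set.Icc (0 : Fin n → ℝ) 1 := by
  have h : ({x : Fin n → ℝ | ∀ i, x i ∈ Set.Ioc ((0 : Fin n → ℝ) i) ((0 : Fin n → ℝ) i + 1)}
      : Set (Fin n → ℝ)) = Set.pi Set.univ fun i => Set.Ioc ((0 : Fin n → ℝ) i)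
        ((1 : Fin n → ℝ) i) := by
    ext x; simp
  rw [h]
  exact Measure.univ_pi_Ioc_ae_eq_Icc

/-- Both sides are the integral of `torusLift f`, read off in the fundamental boxes based at s and
at 0. -/
theorem setIntegral_Icc_add {f : (Fin n → ℝ) → ℂ}
    (hf : ∀ x (m : Fin n → ℤ), f (fun i => x i + m i) = f x) (s : Fin n → ℝ) :
    ∫ x in Set.Icc (0 : Fin n → ℝ) 1, f (x + s) = ∫ x in Set.Icc (0 : Fin n → ℝ) 1, f x := by
  have h0 := UnitAddTorus.integral_preimage (torusLift f) (0 : Fin n → ℝ)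
  have h1 := UnitAddTorus.integral_preimage (torusLift f) s
  simp only [torusLift_coe hf] at h0 h1
  rw [← setIntegral_congr_set Ioc_ae_eq_Icc_pi, ← setIntegral_congr_set Ioc_ae_eq_Icc_pi, ← h0, h1]
  have := (measurePreserving_add_right (volume : Measure (Fin n → ℝ)) s).setIntegral_preimage_emb
    (MeasurableEquiv.addRight s).measurableEmbedding f
    {x : Fin n → ℝ | ∀ i, x i ∈ Set.Ioc (s i) (s i + 1)}
  rw [← this]
  congr 2
  ext x
  simp only [Set.mem_ofPred_eq, Set.mem_preimage, Set.mem_Ioc, Pi.zero_apply, Pi.add_apply]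
  refine forall_congr' fun i => ?_
  constructor <;> rintro ⟨h1, h2⟩ <;> constructor <;> linarith

/-! ### Shifting the domain of integration -/

namespace StripAnalytic

variable {R : ℝ} {u : (Fin n → ℂ) → ℂ}

theorem periodic_shift (hu : StripAnalytic R u) {η : Fin n → ℝ} (hη : ∀ i, |η i| < R)
    (x : Fin n → ℝ) (m : Fin n → ℤ) : u (shift (fun i => x i + m i) η) = u (shift x η) := by
  rw [← hu.periodic (shift x η) (fun i => by rw [shift_im]; exact hη i) m]
  congr 1
  ext i
  simp only [shift]
  push_cast
  ring

theorem continuous_shift (hu : StripAnalytic R u) {η : Fin n → ℝ} (hη : ∀ i, |η i| < R) :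
    Continuous fun x => u (shift x η) := by
  refine hu.continuousOn.comp_continuous (CohomEq.continuous_shift.comp
    (Continuous.prodMk continuous_id continuous_const)) fun x i => ?_
  simp only [shift_im]
  exact hη i

/-- The mean of `u` over the real torus translated by `z` depends analytically on `z`. -/
theorem differentiableAt_mean (hu : StripAnalytic R u) {z : Fin n → ℂ} (hz : z ∈ strip n R) :
    DifferentiableAt ℂ
      (fun z => ∫ x in Set.Icc (0 : Fin n → ℝ) 1, u (fun i => (x i : ℂ) + z i)) z := by
  have hadd : Continuous fun p : (Fin n → ℂ) × (Fin n → ℝ) =>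
      (fun i => (p.2 i : ℂ) + p.1 i : Fin n → ℂ) := by fun_prop
  have hmem : ∀ z' ∈ strip n R, ∀ x : Fin n → ℝ, (fun i => (x i : ℂ) + z' i) ∈ strip n R := by
    intro z' hz' x i
    simpa using hz' i
  obtain ⟨ε, hε, hball⟩ := Metric.nhds_basis_closedBall.mem_iff.1
    ((isOpen_strip R).mem_nhds hz)
  have hfd : ContinuousOn (fderiv ℂ u) (strip n R) := hu.analytic.fderiv.continuousOn
  have hfc : ContinuousOn (fun p : (Fin n → ℂ) × (Fin n → ℝ) =>
      fderiv ℂ u (fun i => (p.2 i : ℂ) + p.1 i))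
      (Metric.closedBall z ε ×ˢ Set.Icc (0 : Fin n → ℝ) 1) :=
    ContinuousOn.comp' (t := strip n R) hfd hadd.continuousOn
      fun p hp => hmem p.1 (hball hp.1) p.2
  -- The constant dominating the derivative, from compactness of ball × cube, for differentiation
  -- under the integral.
  obtain ⟨C, hC⟩ := ((isCompact_closedBall z ε).prod isCompact_Icc).bddAbove_image hfc.norm
  have hcont : ∀ z' ∈ strip n R,
      Continuous fun x : Fin n → ℝ => u (fun i => (x i : ℂ) + z' i) := fun z' hz' =>
    hu.continuousOn.comp_continuous (by fun_prop) fun x => hmem z' hz' x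
  have hcont' : Continuous fun x : Fin n → ℝ => fderiv ℂ u (fun i => (x i : ℂ) + z i) :=
    hfd.comp_continuous (by fun_prop) fun x => hmem z hz x
  have hmeas : ∀ᶠ z' in 𝓝 z, AEStronglyMeasurable
      (fun x : Fin n → ℝ => u (fun i => (x i : ℂ) + z' i))
      (volume.restrict (Set.Icc (0 : Fin n → ℝ) 1)) := by
    filter_upwards [(isOpen_strip R).mem_nhds hz] with z' hz'
    exact (hcont z' hz').aestronglyMeasurable
  have hint : Integrable (fun x : Fin n → ℝ => u (fun i => (x i : ℂ) + z i))
      (volume.restrict (Set.Icc (0 : Fin n → ℝ) 1)) :=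
    (hcont z hz).continuousOn.integrableOn_compact isCompact_Icc
  have hbound : ∀ᵐ x : Fin n → ℝ ∂(volume.restrict (Set.Icc (0 : Fin n → ℝ) 1)),
      ∀ z' ∈ Metric.closedBall z ε, ‖fderiv ℂ u (fun i => (x i : ℂ) + z' i)‖ ≤ C :=
    (ae_restrict_iff' measurableSet_Icc).2 (ae_of_all _ fun x hx z' hz' =>
      hC ⟨(z', x), ⟨hz', hx⟩, rfl⟩)
  have hC' : Integrable (fun _ : Fin n → ℝ => C) (volume.restrict (Set.Icc (0 : Fin n → ℝ) 1)) :=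
    integrableOn_const (isCompact_Icc.measure_lt_top.ne)
  have hderiv : ∀ x : Fin n → ℝ, ∀ z' ∈ Metric.closedBall z ε,
      HasFDerivAt (fun z' : Fin n → ℂ => u (fun i => (x i : ℂ) + z' i))
        (fderiv ℂ u (fun i => (x i : ℂ) + z' i)) z' := by
    intro x z' hz'
    have h1 := (hu.analytic _ (hmem z' (hball hz') x)).differentiableAt.hasFDerivAt
    exact (hasFDerivAt_comp_add_left (fun i => (x i : ℂ))).2 h1
  exact (hasFDerivAt_integral_of_dominated_of_fderiv_le (Metric.closedBall_mem_nhds z hε)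
    hmeas hint hcont'.aestronglyMeasurable hbound hC' (ae_of_all _ hderiv)).differentiableAt

/-- The mean of `u` does not change when the real torus is moved inside the strip. -/
theorem mean_shift (hu : StripAnalytic R u) {η : Fin n → ℝ} (hη : ∀ i, |η i| < R) :
    ∫ x in Set.Icc (0 : Fin n → ℝ) 1, u (shift x η) =
      ∫ x in Set.Icc (0 : Fin n → ℝ) 1, u (fun i => (x i : ℂ)) := by
  set G : (Fin n → ℂ) → ℂ :=
    fun z => ∫ x in Set.Icc (0 : Fin n → ℝ) 1, u (fun i => (x i : ℂ) + z i) with hG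
  -- `G` is invariant under real translations, so its derivative kills real vectors. Being complex
  -- linear, the derivative then vanishes altogether, and `G` is constant on the connected strip.
  -- This plays the role of Cauchy's theorem.
  have htrans : ∀ z ∈ strip n R, ∀ s : Fin n → ℝ, G (z + fun i => (s i : ℂ)) = G z := by
    intro z hz s
    simp only [hG]
    rw [← setIntegral_Icc_add (f := fun x => u (fun i => (x i : ℂ) + z i)) _ s]
    · simp only [Pi.add_apply, Complex.ofReal_add, add_comm, add_left_comm]
    · intro x m
      rw [← hu.periodic (fun i => (x i : ℂ) + z i) (fun i => by simpa using hz i) m]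
      congr 1
      ext i
      push_cast
      ring
  have hreal : ∀ z ∈ strip n R, ∀ s : Fin n → ℝ, fderiv ℂ G z (fun i => (s i : ℂ)) = 0 := by
    intro z hz s
    have h1 := (hu.differentiableAt_mean hz).hasFDerivAt
    have h2 : HasDerivAt (fun t : ℝ => G (z + fun i => ((t * s i : ℝ) : ℂ)))
        (fderiv ℂ G z (fun i => (s i : ℂ))) 0 := by
      have h3 : HasDerivAt (fun t : ℝ => (z + fun i => ((t * s i : ℝ) : ℂ) : Fin n → ℂ))
          (fun i => (s i : ℂ)) 0 := by
        rw [hasDerivAt_pi]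
        intro i
        have := ((hasDerivAt_id (0 : ℝ)).mul_const (s i)).ofReal_comp.const_add (z i)
        simpa using this
      have h4 : z = (z + fun i => ((0 * s i : ℝ) : ℂ) : Fin n → ℂ) := by ext i; simp
      rw [h4] at h1
      have h6 := (h1.restrictScalars ℝ).comp_hasDerivAt (0 : ℝ) h3
      rw [← h4] at h6
      exact h6
    have h5 : (fun t : ℝ => G (z + fun i => ((t * s i : ℝ) : ℂ))) = fun _ => G z :=
      funext fun t => htrans z hz fun i => t * s i
    rw [h5] at h2
    exact h2.unique (hasDerivAt_const _ _)
  have hzero : ∀ z ∈ strip n R, fderiv ℂ G z = 0 := by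
    intro z hz
    ext w
    have hw : w = (fun i => ((w i).re : ℂ)) + Complex.I • (fun i => ((w i).im : ℂ)) := by
      ext i
      simp [mul_comm Complex.I, Complex.re_add_im]
    rw [hw, map_add, map_smul, hreal z hz, hreal z hz]
    simp
  have hη' : shift 0 η ∈ strip n R := fun i => by rw [shift_im]; exact hη i
  have h0 : (0 : Fin n → ℂ) ∈ strip n R := fun i => by
    simpa using (abs_nonneg (η i)).trans_lt (hη i)
  have := (isOpen_strip R).is_const_of_fderiv_eq_zero (convex_strip R).isPreconnected
    (fun z hz => (hu.differentiableAt_mean hz).differentiableWithinAt) (fun z hz => hzero z hz)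
    hη' h0
  have e : ∀ x, shift x η = fun i => (x i : ℂ) + (η i : ℂ) * Complex.I := fun _ => rfl
  simpa only [hG, e, Pi.zero_apply, Complex.ofReal_zero, zero_add, add_zero] using this

end StripAnalytic

/-! ### Fourier series on strips -/

theorem mFourier_coe (k : Fin n → ℤ) (x : Fin n → ℝ) :
    UnitAddTorus.mFourier k (fun i => (x i : UnitAddCircle)) = expo k (fun i => (x i : ℂ)) := by
  simp only [UnitAddTorus.mFourier, ContinuousMap.coe_mk, fourier_coe_apply, expo,
    ← Complex.exp_sum, Finset.mul_sum]
  congr 2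
  ext i
  push_cast
  ring

theorem torus_induction {P : UnitAddTorus (Fin n) → Prop}
    (h : ∀ x : Fin n → ℝ, P fun i => (x i : UnitAddCircle)) (y : UnitAddTorus (Fin n)) : P y := by
  choose x hx using fun i => QuotientAddGroup.mk_surjective (y i)
  have : y = fun i => (x i : UnitAddCircle) := funext fun i => (hx i).symm
  exact this ▸ h x

/-- Bessel's inequality for continuous functions on the torus. -/
theorem sum_sq_mFourierCoeff_le (f : C(UnitAddTorus (Fin n), ℂ)) {M : ℝ} (hM : ∀ y, ‖f y‖ ≤ M)
    (s : Finset (Fin n → ℤ)) : ∑ k ∈ s, ‖UnitAddTorus.mFourierCoeff f k‖ ^ 2 ≤ M ^ 2 := by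
  -- With normalised Haar measure the torus has mass one, so the sup bound passes to the L² norm
  -- without a constant.
  let _ : MeasureSpace UnitAddCircle := ⟨AddCircle.haarAddCircle⟩
  have _ : Measure.IsAddHaarMeasure (volume : Measure UnitAddCircle) :=
    inferInstanceAs (Measure.IsAddHaarMeasure AddCircle.haarAddCircle)
  have _ : IsProbabilityMeasure (volume : Measure UnitAddCircle) :=
    inferInstanceAs (IsProbabilityMeasure AddCircle.haarAddCircle)
  have h := UnitAddTorus.hasSum_sq_mFourierCoeff (ContinuousMap.toLp 2 volume ℂ f)
  simp only [UnitAddTorus.mFourierCoeff_toLp] at h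
  refine (sum_le_hasSum s (fun _ _ => by positivity) h).trans ?_
  have h1 : ∀ᵐ t ∂(volume : Measure (UnitAddTorus (Fin n))),
      ‖‖(ContinuousMap.toLp 2 volume ℂ f) t‖ ^ 2‖ ≤ M ^ 2 := by
    filter_upwards [ContinuousMap.coeFn_toLp (𝕜 := ℂ) (p := 2)
      (volume : Measure (UnitAddTorus (Fin n))) f] with t ht
    rw [ht, Real.norm_eq_abs, abs_of_nonneg (by positivity)]
    exact pow_le_pow_left₀ (norm_nonneg _) (hM t) 2
  have h2 := norm_integral_le_of_norm_le_const h1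
  rw [probReal_univ, mul_one] at h2
  exact (le_abs_self _).trans h2

namespace StripAnalytic

variable {R : ℝ} {u : (Fin n → ℂ) → ℂ}

theorem fourierCoef_eq (u : (Fin n → ℂ) → ℂ) (k : Fin n → ℤ) :
    fourierCoef u k = ∫ x in Set.Icc (0 : Fin n → ℝ) 1,
      u (fun i => (x i : ℂ)) * expo (-k) (fun i => (x i : ℂ)) := by
  simp only [fourierCoef, expo_neg]

/-- Apply `mean_shift` to the product of u with `expo (-k)`; the factor is what `expo (-k)` picks up
at height η. -/
theorem mFourierCoeff_torusLift (hu : StripAnalytic R u) {η : Fin n → ℝ} (hη : ∀ i, |η i| < R)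
    (k : Fin n → ℤ) :
    UnitAddTorus.mFourierCoeff (torusLift fun x => u (shift x η)) k =
      fourierCoef u k * (Real.exp (-(2 * Real.pi * ∑ i, (k i : ℝ) * η i)) : ℝ) := by
  rw [UnitAddTorus.mFourierCoeff_eq_integral _ _ 0, setIntegral_congr_set Ioc_ae_eq_Icc_pi,
    fourierCoef_eq]
  simp only [torusLift_coe (f := fun x => u (shift x η)) (hu.periodic_shift hη), mFourier_coe]
  rw [← (hu.mul (stripAnalytic_expo R (-k))).mean_shift hη, ← integral_mul_const]
  congr 1
  ext x
  simp only [smul_eq_mul, expo_shift, Pi.neg_apply, Int.cast_neg, neg_mul, Finset.sum_neg_distrib,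
    mul_neg, neg_neg]
  have : ((Real.exp (2 * Real.pi * ∑ i, (k i : ℝ) * η i) : ℝ) : ℂ) *
      (Real.exp (-(2 * Real.pi * ∑ i, (k i : ℝ) * η i)) : ℝ) = 1 := by
    rw [← Complex.ofReal_mul, ← Real.exp_add, add_neg_cancel, Real.exp_zero, Complex.ofReal_one]
  linear_combination (-u (shift x η) * expo (-k) fun i => (x i : ℂ)) * this

/-- The function on the torus given by a horizontal slice of `u`. -/
def slice (hu : StripAnalytic R u) {η : Fin n → ℝ} (hη : ∀ i, |η i| < R) :
    C(UnitAddTorus (Fin n), ℂ) :=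
  ⟨torusLift fun x => u (shift x η),
    continuous_torusLift (hu.continuous_shift hη) (hu.periodic_shift hη)⟩

theorem slice_coe (hu : StripAnalytic R u) {η : Fin n → ℝ} (hη : ∀ i, |η i| < R)
    (x : Fin n → ℝ) : hu.slice hη (fun i => (x i : UnitAddCircle)) = u (shift x η) :=
  torusLift_coe (f := fun x => u (shift x η)) (hu.periodic_shift hη) x

theorem mFourierCoeff_slice (hu : StripAnalytic R u) {η : Fin n → ℝ} (hη : ∀ i, |η i| < R)
    (k : Fin n → ℤ) : UnitAddTorus.mFourierCoeff (hu.slice hη) k =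
      fourierCoef u k * (Real.exp (-(2 * Real.pi * ∑ i, (k i : ℝ) * η i)) : ℝ) :=
  hu.mFourierCoeff_torusLift hη k

theorem bessel_slice (hu : StripAnalytic R u) {ρ : ℝ} (hρ : ρ < R) {η : Fin n → ℝ}
    (hη : ∀ i, |η i| ≤ ρ) (s : Finset (Fin n → ℤ)) :
    ∑ k ∈ s, (‖fourierCoef u k‖ * Real.exp (-(2 * Real.pi * ∑ i, (k i : ℝ) * η i))) ^ 2 ≤
      stripNorm ρ u ^ 2 := by
  have hη' : ∀ i, |η i| < R := fun i => (hη i).trans_lt hρ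
  have h := sum_sq_mFourierCoeff_le (hu.slice hη') (M := stripNorm ρ u)
    (torus_induction fun x => by
      rw [slice_coe]
      exact hu.norm_le_stripNorm hρ fun i => by rw [shift_im]; exact hη i) s
  simpa only [mFourierCoeff_slice, norm_mul, Complex.norm_real, Real.norm_eq_abs, Real.abs_exp]
    using h

/-- The vector with entries `±ρ`. -/
def corner (ρ : ℝ) (σ : Fin n → Bool) : Fin n → ℝ := fun i => if σ i then ρ else -ρ

theorem abs_corner {ρ : ℝ} (hρ : 0 ≤ ρ) (σ : Fin n → Bool) (i : Fin n) : |corner ρ σ i| ≤ ρ := by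
  unfold corner
  split_ifs <;> simp [abs_of_nonneg hρ]

/-- Choosing each sign opposite to that of k_i makes the slice at this corner carry the largest
possible weight for the mode k. -/
theorem exists_corner (ρ : ℝ) (k : Fin n → ℤ) :
    ∃ σ, -(∑ i, (k i : ℝ) * corner ρ σ i) = ρ * l1 k := by
  refine ⟨fun i => decide (k i ≤ 0), ?_⟩
  rw [l1_cast, ← Finset.sum_neg_distrib, Finset.mul_sum]
  refine Finset.sum_congr rfl fun i _ => ?_
  by_cases h : k i ≤ 0
  · have : (k i : ℝ) ≤ 0 := by exact_mod_cast h
    simp only [corner, h, decide_true, if_true, abs_of_nonpos this]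
    ring
  · have : 0 < (k i : ℝ) := by exact_mod_cast not_le.1 h
    simp only [corner, h, decide_false, Bool.false_eq_true, if_false, abs_of_pos this]
    ring

/-- The best corner depends on k, so each term is bounded by its sum over all corners; Bessel at
each of them produces the factor 2^n. -/
theorem sum_sq_fourierCoef_le (hu : StripAnalytic R u) {ρ : ℝ} (h0 : 0 ≤ ρ) (hρ : ρ < R)
    (s : Finset (Fin n → ℤ)) :
    ∑ k ∈ s, (‖fourierCoef u k‖ * Real.exp (2 * Real.pi * ρ * l1 k)) ^ 2 ≤
      2 ^ n * stripNorm ρ u ^ 2 := by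
  calc ∑ k ∈ s, (‖fourierCoef u k‖ * Real.exp (2 * Real.pi * ρ * l1 k)) ^ 2
      ≤ ∑ k ∈ s, ∑ σ : Fin n → Bool, (‖fourierCoef u k‖ *
          Real.exp (-(2 * Real.pi * ∑ i, (k i : ℝ) * corner ρ σ i))) ^ 2 := by
        refine Finset.sum_le_sum fun k _ => ?_
        obtain ⟨σ, hσ⟩ := exists_corner ρ k
        have : 2 * Real.pi * ρ * l1 k = -(2 * Real.pi * ∑ i, (k i : ℝ) * corner ρ σ i) := by
          linear_combination -(2 * Real.pi) * hσ
        rw [this]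
        exact Finset.single_le_sum (f := fun σ : Fin n → Bool => (‖fourierCoef u k‖ *
          Real.exp (-(2 * Real.pi * ∑ i, (k i : ℝ) * corner ρ σ i))) ^ 2)
          (fun _ _ => by positivity) (Finset.mem_univ σ)
    _ = ∑ σ : Fin n → Bool, ∑ k ∈ s, (‖fourierCoef u k‖ *
          Real.exp (-(2 * Real.pi * ∑ i, (k i : ℝ) * corner ρ σ i))) ^ 2 := Finset.sum_comm
    _ ≤ ∑ _σ : Fin n → Bool, stripNorm ρ u ^ 2 :=
        Finset.sum_le_sum fun σ _ => hu.bessel_slice hρ (abs_corner h0 σ) s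
    _ = 2 ^ n * stripNorm ρ u ^ 2 := by simp

/-- Bessel's inequality with a single term, on the slice at the best corner for k. -/
theorem norm_fourierCoef_le (hu : StripAnalytic R u) {ρ : ℝ} (h0 : 0 ≤ ρ) (hρ : ρ < R)
    (k : Fin n → ℤ) :
    ‖fourierCoef u k‖ ≤ stripNorm ρ u * Real.exp (-(2 * Real.pi * ρ * l1 k)) := by
  obtain ⟨σ, hσ⟩ := exists_corner ρ k
  have h := hu.bessel_slice hρ (abs_corner h0 σ) {k}
  have : -(2 * Real.pi * ∑ i, (k i : ℝ) * corner ρ σ i) = 2 * Real.pi * ρ * l1 k := by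
    linear_combination (2 * Real.pi) * hσ
  rw [Finset.sum_singleton, this] at h
  have h2 := (pow_le_pow_iff_left₀ (by positivity) (stripNorm_nonneg _ _) two_ne_zero).1 h
  rw [Real.exp_neg, ← div_eq_mul_inv, le_div_iff₀ (Real.exp_pos _)]
  exact h2

end StripAnalytic

/-! ### Sums of products over `ℤⁿ` -/

theorem hasSum_prod_pi {n : ℕ} {f : Fin n → ℤ → ℝ} {a : Fin n → ℝ} (h0 : ∀ i m, 0 ≤ f i m)
    (h : ∀ i, HasSum (f i) (a i)) : HasSum (fun k : Fin n → ℤ => ∏ i, f i (k i)) (∏ i, a i) := by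
  induction n with
  | zero =>
    simp only [Finset.univ_eq_empty, Finset.prod_empty]
    exact hasSum_unique (fun _ : Fin 0 → ℤ => (1 : ℝ))
  | succ n ih =>
    obtain ⟨g, hg⟩ : ∃ g : (Fin n → ℤ) → ℝ, ∀ k, g k = ∏ i, f i.succ (k i) := ⟨_, fun _ => rfl⟩
    obtain ⟨b, hb⟩ : ∃ b : ℝ, b = ∏ i : Fin n, a i.succ := ⟨_, rfl⟩
    have h1 : HasSum g b := by
      rw [hb, funext hg]
      exact ih (fun i => h0 i.succ) fun i => h i.succ
    have hg0 : 0 ≤ g := fun k => by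
      rw [hg]
      exact Finset.prod_nonneg fun i _ => h0 i.succ (k i)
    have hs := Summable.mul_of_nonneg (h 0).summable h1.summable (h0 0) hg0
    have h2 := (h 0).mul h1 hs
    rw [Fin.prod_univ_succ, ← hb, ← (Fin.consEquiv fun _ => ℤ).hasSum_iff]
    refine h2.congr_fun fun p => ?_
    simp [Fin.consEquiv, Fin.prod_univ_succ, hg]

theorem hasSum_int_of_pos_of_neg {f : ℤ → ℝ} {a b : ℝ}
    (ha : HasSum (fun j : ℕ => f (j + 1)) a) (hb : HasSum (fun j : ℕ => f (-(j + 1))) b) :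
    HasSum f (f 0 + a + b) := by
  have h1 : HasSum (fun j : ℕ => f j) (f 0 + a) := by
    have := (hasSum_nat_add_iff (f := fun j : ℕ => f j) 1).1 (by simpa using ha)
    simpa [add_comm] using this
  exact HasSum.of_nat_of_neg_add_one h1 hb

theorem hasSum_int_of_symm {f : ℤ → ℝ} {a : ℝ} (hf : ∀ m, f (-m) = f m)
    (h : HasSum (fun j : ℕ => f (j + 1)) a) : HasSum f (f 0 + 2 * a) := by
  have := hasSum_int_of_pos_of_neg h (by simpa only [hf] using h)
  rwa [add_assoc, ← two_mul] at this

/-- `∑_{m ∈ ℤ} e^{-2πδ|m|}`. -/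
theorem hasSum_exp_abs {δ : ℝ} (hδ : 0 < δ) :
    HasSum (fun m : ℤ => Real.exp (-(2 * Real.pi * δ * |(m : ℝ)|)))
      ((Real.exp (2 * Real.pi * δ) + 1) / (Real.exp (2 * Real.pi * δ) - 1)) := by
  set q := Real.exp (-(2 * Real.pi * δ)) with hq
  have hpos : 0 < 2 * Real.pi * δ := by positivity
  have hq1 : q < 1 := by rw [hq, Real.exp_lt_one_iff]; linarith
  have hq0 : 0 < q := Real.exp_pos _
  have h1 : HasSum (fun j : ℕ => Real.exp (-(2 * Real.pi * δ * |(((j : ℤ) + 1 : ℤ) : ℝ)|)))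
      (q * (1 - q)⁻¹) := by
    refine ((hasSum_geometric_of_lt_one hq0.le hq1).mul_left q).congr_fun fun j => ?_
    rw [hq, ← Real.exp_nat_mul, ← Real.exp_add]
    congr 1
    push_cast
    rw [abs_of_nonneg (by positivity)]
    ring
  convert hasSum_int_of_symm (f := fun m : ℤ => Real.exp (-(2 * Real.pi * δ * |(m : ℝ)|)))
    (fun m => by simp) h1 using 1
  have : Real.exp (2 * Real.pi * δ) = q⁻¹ := by rw [hq, Real.exp_neg, inv_inv]
  rw [this]
  have : 1 - q ≠ 0 := by linarith
  have h3 : q⁻¹ - 1 ≠ 0 := by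
    have := (one_lt_inv₀ hq0).2 hq1
    linarith
  simp only [Int.cast_zero, abs_zero, mul_zero, neg_zero, Real.exp_zero]
  field_simp
  ring

theorem exp_l1 (c : ℝ) (k : Fin n → ℤ) :
    Real.exp (-(c * l1 k)) = ∏ i, Real.exp (-(c * |(k i : ℝ)|)) := by
  rw [l1_cast, Finset.mul_sum, ← Finset.sum_neg_distrib, Real.exp_sum]

theorem hasSum_exp_l1 {δ : ℝ} (hδ : 0 < δ) :
    HasSum (fun k : Fin n → ℤ => Real.exp (-(2 * Real.pi * δ * l1 k)))
      (((Real.exp (2 * Real.pi * δ) + 1) / (Real.exp (2 * Real.pi * δ) - 1)) ^ n) := by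
  have := hasSum_prod_pi (n := n) (fun _ _ => (Real.exp_pos _).le) fun _ => hasSum_exp_abs hδ
  simpa only [exp_l1, Finset.prod_const, Finset.card_univ, Fintype.card_fin] using this

namespace StripAnalytic

variable {R : ℝ} {u : (Fin n → ℂ) → ℂ}

/-- An analytic function on a strip is the sum of its Fourier series. -/
theorem hasSum_fourier (hu : StripAnalytic R u) {θ : Fin n → ℂ} (hθ : θ ∈ strip n R)
    (hR : 0 < R) : HasSum (fun k => fourierCoef u k * expo k θ) (u θ) := by
  -- ρ is the largest |Im θ_i|; inserting 0 keeps the maximum defined when n = 0.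
  obtain ⟨ρ, hρ0, hρ, hρR⟩ : ∃ ρ, 0 ≤ ρ ∧ (∀ i, |(θ i).im| ≤ ρ) ∧ ρ < R := by
    have hne : (insert 0 (Finset.univ.image fun i => |(θ i).im|)).Nonempty :=
      Finset.insert_nonempty _ _
    refine ⟨(insert 0 (Finset.univ.image fun i => |(θ i).im|)).max' hne, ?_, fun i => ?_, ?_⟩
    · exact Finset.le_max' _ _ (by simp)
    · exact Finset.le_max' _ _ (by simp)
    · rw [Finset.max'_lt_iff]
      simp only [Finset.mem_insert, Finset.mem_image, Finset.mem_univ, true_and]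
      rintro _ (rfl | ⟨i, rfl⟩)
      · exact hR
      · exact hθ i
  -- Decay at a larger width ρ' leaves the summable factor e^{-2π(ρ'-ρ)|k|}.
  obtain ⟨ρ', h1, h2⟩ := exists_between hρR
  have hη : ∀ i, |(θ i).im| < R := hθ
  have hsum : Summable (UnitAddTorus.mFourierCoeff (hu.slice hη)) := by
    refine Summable.of_norm_bounded (((hasSum_exp_l1 (n := n) (sub_pos.2 h1)).summable).mul_left
      (stripNorm ρ' u)) fun k => ?_
    rw [hu.mFourierCoeff_slice, norm_mul, Complex.norm_real, Real.norm_eq_abs, Real.abs_exp,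
      ← norm_expo]
    refine (mul_le_mul (hu.norm_fourierCoef_le (hρ0.trans h1.le) h2 k)
      (norm_expo_le k hρ) (norm_nonneg _)
      (mul_nonneg (stripNorm_nonneg _ _) (Real.exp_pos _).le)).trans_eq ?_
    rw [mul_assoc, ← Real.exp_add]
    congr 2
    ring
  have h3 := UnitAddTorus.hasSum_mFourier_series_apply_of_summable hsum
    (fun i => ((θ i).re : UnitAddCircle))
  rw [slice_coe, shift_re_im] at h3
  convert h3 using 1
  ext k
  rw [hu.mFourierCoeff_slice, mFourier_coe, smul_eq_mul, mul_assoc, ← expo_shift, shift_re_im]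

end StripAnalytic

/-! ### Sums of small divisors -/

theorem summable_hurwitz {β : ℝ} (hβ : 0 < β) : Summable fun j : ℕ => (β + j) ^ (-2 : ℝ) := by
  refine ((Real.summable_one_div_nat_add_rpow β 2).2 one_lt_two).congr fun j => ?_
  rw [abs_of_pos (by positivity), add_comm, Real.rpow_neg (by positivity), one_div]

theorem hurwitz_nonneg {β : ℝ} (hβ : 0 < β) : 0 ≤ hurwitz 2 β :=
  tsum_nonneg fun j => by positivity

/-- A sum of inverse squares over `d`-separated points that are at least `β d`. -/
theorem sum_inv_sq_le_of_separated {ι : Type*} (s : Finset ι) (y : ι → ℝ) {β d : ℝ} (hβ : 0 < β)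
    (hd : 0 < d) (hlow : ∀ k ∈ s, β * d ≤ y k)
    (hsep : ∀ k ∈ s, ∀ l ∈ s, k ≠ l → d ≤ |y k - y l|) :
    ∑ k ∈ s, 1 / y k ^ 2 ≤ hurwitz 2 β / d ^ 2 := by
  classical
  -- The number of whole steps d from βd up to y_k. Separation makes it injective, so distinct
  -- points are compared with distinct terms of the zeta series.
  set j : ι → ℕ := fun k => ⌊(y k - β * d) / d⌋₊ with hj
  have hj0 : ∀ k ∈ s, 0 ≤ (y k - β * d) / d := fun k hk =>
    div_nonneg (sub_nonneg.2 (hlow k hk)) hd.le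
  have hinj : Set.InjOn j s := by
    intro k hk l hl hkl
    by_contra hne
    have h1 := hsep k hk l hl hne
    have hk1 := Nat.floor_le (hj0 k hk)
    have hk2 := Nat.lt_floor_add_one ((y k - β * d) / d)
    have hl1 := Nat.floor_le (hj0 l hl)
    have hl2 := Nat.lt_floor_add_one ((y l - β * d) / d)
    have hkl' : (⌊(y k - β * d) / d⌋₊ : ℝ) = ⌊(y l - β * d) / d⌋₊ := by exact_mod_cast hkl
    have h2 : |(y k - β * d) / d - (y l - β * d) / d| < 1 := by
      rw [abs_lt]; constructor <;> linarith
    rw [← sub_div, sub_sub_sub_cancel_right, abs_div, abs_of_pos hd, div_lt_one hd] at h2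
    linarith
  have hterm : ∀ k ∈ s, 1 / y k ^ 2 ≤ (β + j k) ^ (-2 : ℝ) / d ^ 2 := by
    intro k hk
    have h1 := Nat.floor_le (hj0 k hk)
    rw [le_div_iff₀ hd] at h1
    have h2 : (β + j k) * d ≤ y k := by simp only [hj]; linarith
    have h3 : 0 < β + j k := by positivity
    rw [Real.rpow_neg h3.le, Real.rpow_two, inv_eq_one_div, div_div, ← mul_pow]
    gcongr
  calc ∑ k ∈ s, 1 / y k ^ 2 ≤ ∑ k ∈ s, (β + j k) ^ (-2 : ℝ) / d ^ 2 := Finset.sum_le_sum hterm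
    _ = (∑ m ∈ s.image j, (β + m) ^ (-2 : ℝ)) / d ^ 2 := by
        rw [Finset.sum_image hinj, Finset.sum_div]
    _ ≤ hurwitz 2 β / d ^ 2 := by
        gcongr
        exact (summable_hurwitz hβ).sum_le_tsum _ fun m _ => by positivity

/-- Jordan's inequality |sin t| ≥ 2|t|/π on [-π/2, π/2], after subtracting the nearest integer. -/
theorem two_mul_abs_sub_round_le (x : ℝ) : 2 * |x - round x| ≤ |Real.sin (Real.pi * x)| := by
  have h1 : |Real.sin (Real.pi * x)| = |Real.sin (Real.pi * (x - round x))| := by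
    have : Real.pi * (x - round x) = Real.pi * x - (round x : ℤ) * Real.pi := by ring
    rw [this, Real.sin_sub_int_mul_pi, abs_mul]
    simp
  have h2 := abs_sub_round x
  rw [h1]
  have h3 := Real.mul_abs_le_abs_sin (x := Real.pi * (x - round x)) (by
    rw [abs_mul, abs_of_pos Real.pi_pos]
    nlinarith [Real.pi_pos])
  rw [abs_mul, abs_of_pos Real.pi_pos] at h3
  convert h3 using 1
  field_simp

theorem l1_pos {k : Fin n → ℤ} (hk : k ≠ 0) : 0 < l1 k := by
  obtain ⟨i, hi⟩ := Function.ne_iff.1 hk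
  exact Finset.sum_pos' (fun _ _ => Nat.zero_le _) ⟨i, Finset.mem_univ i, Int.natAbs_pos.2 hi⟩

theorem l1_sub_le (k l : Fin n → ℤ) : l1 (k - l) ≤ l1 k + l1 l := by
  unfold l1
  rw [← Finset.sum_add_distrib]
  exact Finset.sum_le_sum fun i _ => Int.natAbs_sub_le _ _

namespace IsDiophantine

variable {γ τ : ℝ} {ω : Fin n → ℝ}

theorem tau_nonneg (hω : IsDiophantine γ τ ω) : 0 ≤ τ := (Nat.cast_nonneg n).trans hω.2.1

theorem lower_bound (hω : IsDiophantine γ τ ω) {k : Fin n → ℤ} (hk : k ≠ 0) {X : ℝ}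
    (hX : (l1 k : ℝ) ≤ X) (m : ℤ) : γ * X ^ (-τ) ≤ |∑ i, (k i : ℝ) * ω i - m| := by
  refine le_trans ?_ (hω.2.2 k hk m)
  have h0 : (0 : ℝ) < l1 k := by exact_mod_cast l1_pos hk
  exact mul_le_mul_of_nonneg_left
    (Real.rpow_le_rpow_of_nonpos h0 hX (neg_nonpos.2 hω.tau_nonneg)) hω.1.le

/-- Two indices of size at most X differ by one of size at most 2X. So the signed distances y_k to
the nearest integers are d-separated with d = γ(2X)^{-τ}, while |y_k| ≥ γX^{-τ} = 2^τ d. This is the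
origin of the argument 2^τ of the zeta function. -/
theorem sum_divisors_le (hω : IsDiophantine γ τ ω) (s : Finset (Fin n → ℤ)) {X : ℝ} (hX0 : 0 < X)
    (hs : ∀ k ∈ s, k ≠ 0 ∧ (l1 k : ℝ) ≤ X) :
    ∑ k ∈ s, 1 / (4 * |Real.sin (Real.pi * ∑ i, (k i : ℝ) * ω i)| ^ 2) ≤
      1 / 8 * hurwitz 2 (2 ^ τ) * 2 ^ (2 * τ) * X ^ (2 * τ) / γ ^ 2 := by
  set x : (Fin n → ℤ) → ℝ := fun k => ∑ i, (k i : ℝ) * ω i with hx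
  set y : (Fin n → ℤ) → ℝ := fun k => x k - round (x k) with hy
  set d : ℝ := γ * (2 * X) ^ (-τ) with hd
  have hd0 : 0 < d := mul_pos hω.1 (Real.rpow_pos_of_pos (by positivity) _)
  have hβ : (0 : ℝ) < 2 ^ τ := by positivity
  have hβd : 2 ^ τ * d = γ * X ^ (-τ) := by
    rw [hd, Real.mul_rpow zero_le_two hX0.le, Real.rpow_neg zero_le_two]
    field_simp
  have hlow : ∀ k ∈ s, 2 ^ τ * d ≤ |y k| := fun k hk => by
    rw [hβd]
    exact hω.lower_bound (hs k hk).1 (hs k hk).2 _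
  have hsep : ∀ k ∈ s, ∀ l ∈ s, k ≠ l → d ≤ |y k - y l| := by
    intro k hk l hl hkl
    have h1 : (l1 (k - l) : ℝ) ≤ 2 * X := by
      have : (l1 (k - l) : ℝ) ≤ l1 k + l1 l := by exact_mod_cast l1_sub_le k l
      linarith [(hs k hk).2, (hs l hl).2]
    have h2 := hω.lower_bound (sub_ne_zero.2 hkl) h1 (round (x k) - round (x l))
    convert h2 using 2
    simp only [hy, hx, Pi.sub_apply, Int.cast_sub, sub_mul, Finset.sum_sub_distrib]
    ring
  have hterm : ∀ k ∈ s, 1 / (4 * |Real.sin (Real.pi * x k)| ^ 2) ≤ 1 / 16 * (1 / y k ^ 2) := by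
    intro k hk
    have h1 := two_mul_abs_sub_round_le (x k)
    have h2 : 0 < |y k| := (mul_pos hβ hd0).trans_le (hlow k hk)
    have h3 : 0 < y k ^ 2 := by rw [← sq_abs]; positivity
    have h4 : 4 * y k ^ 2 ≤ |Real.sin (Real.pi * x k)| ^ 2 := by
      rw [← sq_abs (y k)]
      nlinarith
    rw [div_mul_div_comm, one_mul]
    apply one_div_le_one_div_of_le (by positivity)
    linarith
  -- Points on either side of 0 are handled separately; the two halves turn 1/16 into 1/8.
  have hpos : ∑ k ∈ s with 0 < y k, 1 / y k ^ 2 ≤ hurwitz 2 (2 ^ τ) / d ^ 2 := by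
    refine sum_inv_sq_le_of_separated _ y hβ hd0 (fun k hk => ?_) fun k hk l hl =>
      hsep k (Finset.mem_filter.1 hk).1 l (Finset.mem_filter.1 hl).1
    have := hlow k (Finset.mem_filter.1 hk).1
    rwa [abs_of_pos (Finset.mem_filter.1 hk).2] at this
  have hneg : ∑ k ∈ s with ¬ 0 < y k, 1 / y k ^ 2 ≤ hurwitz 2 (2 ^ τ) / d ^ 2 := by
    have := sum_inv_sq_le_of_separated (s.filter fun k => ¬ 0 < y k) (fun k => -y k) hβ hd0
      (fun k hk => by
        have := hlow k (Finset.mem_filter.1 hk).1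
        rwa [abs_of_nonpos (not_lt.1 (Finset.mem_filter.1 hk).2)] at this)
      fun k hk l hl hkl => by
        have := hsep k (Finset.mem_filter.1 hk).1 l (Finset.mem_filter.1 hl).1 hkl
        rwa [← abs_neg, neg_sub'] at this
    simpa only [neg_sq] using this
  calc ∑ k ∈ s, 1 / (4 * |Real.sin (Real.pi * x k)| ^ 2)
      ≤ ∑ k ∈ s, 1 / 16 * (1 / y k ^ 2) := Finset.sum_le_sum hterm
    _ = 1 / 16 * (∑ k ∈ s with 0 < y k, 1 / y k ^ 2 + ∑ k ∈ s with ¬ 0 < y k, 1 / y k ^ 2) := by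
        rw [Finset.sum_filter_add_sum_filter_not, Finset.mul_sum]
    _ ≤ 1 / 16 * (hurwitz 2 (2 ^ τ) / d ^ 2 + hurwitz 2 (2 ^ τ) / d ^ 2) := by gcongr
    _ = 1 / 8 * hurwitz 2 (2 ^ τ) * 2 ^ (2 * τ) * X ^ (2 * τ) / γ ^ 2 := by
        have hγ := hω.1
        rw [hd, Real.rpow_neg (by positivity), mul_comm 2 τ, Real.rpow_mul zero_le_two,
          Real.rpow_mul hX0.le, Real.rpow_two, Real.rpow_two, Real.mul_rpow zero_le_two hX0.le]
        field_simp
        ring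

theorem integrableOn_rpow_mul_exp_neg {a c : ℝ} (ha : 0 ≤ a) (hc : 0 ≤ c) :
    IntegrableOn (fun u : ℝ => u ^ a * Real.exp (-u)) (Set.Ioi c) := by
  have h := Real.GammaIntegral_convergent (s := a + 1) (by linarith)
  refine (h.mono_set (Set.Ioi_subset_Ioi hc)).congr_fun (fun u _ => ?_) measurableSet_Ioi
  simp only [add_sub_cancel_right]
  ring

/-- Writing e^{-c|k|} as the integral of e^{-u} over u > c|k| and exchanging sum and integral plays
the role of summation by parts: at each u the surviving indices satisfy |k| < u/c, so
`sum_divisors_le` applies with X = u/c. -/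
theorem sum_divisors_tail_le (hω : IsDiophantine γ τ ω) {δ : ℝ} (hδ : 0 < δ) (L : ℕ)
    (s : Finset (Fin n → ℤ)) (hs : ∀ k ∈ s, L < l1 k) :
    ∑ k ∈ s, Real.exp (-(4 * Real.pi * l1 k * δ)) /
        (4 * |Real.sin (Real.pi * ∑ i, (k i : ℝ) * ω i)| ^ 2) ≤
      1 / 8 * hurwitz 2 (2 ^ τ) * 2 ^ (2 * τ) / (4 * Real.pi * δ) ^ (2 * τ) / γ ^ 2 *
        ∫ u in Set.Ioi (4 * Real.pi * δ * (L + 1)), u ^ (2 * τ) * Real.exp (-u) := by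
  set c := 4 * Real.pi * δ with hc
  have hc0 : 0 < c := by positivity
  set I := Set.Ioi (c * (L + 1)) with hI
  set a : (Fin n → ℤ) → ℝ := fun k => 1 / (4 * |Real.sin (Real.pi * ∑ i, (k i : ℝ) * ω i)| ^ 2)
    with ha
  have hsub : ∀ k ∈ s, Set.Ioi (c * l1 k) ⊆ I := fun k hk => by
    refine Set.Ioi_subset_Ioi (mul_le_mul_of_nonneg_left ?_ hc0.le)
    exact_mod_cast hs k hk
  have hk0 : ∀ k ∈ s, k ≠ 0 := by
    rintro k hk rfl
    have := hs 0 hk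
    simp [l1] at this
  have hexp : ∀ k ∈ s, Real.exp (-(4 * Real.pi * l1 k * δ)) /
        (4 * |Real.sin (Real.pi * ∑ i, (k i : ℝ) * ω i)| ^ 2) =
      ∫ u in I, (Set.Ioi (c * l1 k)).indicator (fun u => a k * Real.exp (-u)) u := by
    intro k hk
    rw [setIntegral_indicator measurableSet_Ioi, Set.inter_eq_right.2 (hsub k hk),
      integral_const_mul, integral_exp_neg_Ioi, ha, hc]
    simp only
    rw [div_eq_mul_one_div, mul_comm]
    congr 3
    ring
  have hint : ∀ k ∈ s, IntegrableOn
      (fun u => (Set.Ioi (c * l1 k)).indicator (fun u => a k * Real.exp (-u)) u) I := by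
    intro k _
    refine IntegrableOn.indicator ?_ measurableSet_Ioi
    exact (integrableOn_exp_neg_Ioi _).const_mul _
  rw [Finset.sum_congr rfl hexp, ← integral_finsetSum _ hint, ← integral_const_mul]
  refine setIntegral_mono_on (integrable_finsetSum _ hint)
    ((integrableOn_rpow_mul_exp_neg (by linarith [hω.tau_nonneg]) (by positivity)).const_mul _)
    measurableSet_Ioi fun u hu => ?_
  have hu0 : 0 < u := lt_trans (by positivity) hu
  simp only [Set.indicator_apply, Set.mem_Ioi]
  rw [← Finset.sum_filter, ← Finset.sum_mul, ← mul_assoc]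
  refine mul_le_mul_of_nonneg_right ?_ (Real.exp_pos _).le
  refine (hω.sum_divisors_le _ (X := u / c) (by positivity) fun k hk => ?_).trans_eq ?_
  · obtain ⟨h1, h2⟩ := Finset.mem_filter.1 hk
    refine ⟨hk0 k h1, ?_⟩
    rw [le_div_iff₀ hc0, mul_comm]
    exact h2.le
  · rw [Real.div_rpow hu0.le hc0.le]
    ring

theorem sum_divisors_le_russmannFactor (hω : IsDiophantine γ τ ω) {δ : ℝ} (hδ : 0 < δ) (L : ℕ)
    (s : Finset (Fin n → ℤ)) (hs : ∀ k ∈ s, k ≠ 0) :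
    2 ^ n * ∑ k ∈ s, Real.exp (-(4 * Real.pi * l1 k * δ)) /
        (4 * |Real.sin (Real.pi * ∑ i, (k i : ℝ) * ω i)| ^ 2) ≤
      (russmannFactor L γ τ ω δ / (γ * δ ^ τ)) ^ 2 := by
  have hγ := hω.1
  set b : (Fin n → ℤ) → ℝ := fun k => Real.exp (-(4 * Real.pi * l1 k * δ)) /
        (4 * |Real.sin (Real.pi * ∑ i, (k i : ℝ) * ω i)| ^ 2) with hb
  have hb0 : ∀ k, 0 ≤ b k := fun k => by positivity
  set J := ∫ u in Set.Ioi (4 * Real.pi * δ * (L + 1)), u ^ (2 * τ) * Real.exp (-u) with hJ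
  have hJ0 : 0 ≤ J := setIntegral_nonneg measurableSet_Ioi fun u hu => by
    have : 0 < u := lt_trans (by positivity) hu
    positivity
  have hH := hurwitz_nonneg (β := 2 ^ τ) (by positivity)
  have h1 : ∑ k ∈ s with l1 k ≤ L, b k ≤ ∑ k ∈ smallIndices n L, b k := by
    refine Finset.sum_le_sum_of_subset_of_nonneg (fun k hk => ?_) fun k _ _ => hb0 k
    rw [mem_smallIndices]
    exact ⟨l1_pos (hs k (Finset.mem_filter.1 hk).1), (Finset.mem_filter.1 hk).2⟩
  have h2 := hω.sum_divisors_tail_le hδ L (s.filter fun k => ¬ l1 k ≤ L)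
    fun k hk => not_le.1 (Finset.mem_filter.1 hk).2
  have hsq : (δ ^ τ) ^ 2 = δ ^ (2 * τ) := by
    rw [mul_comm, Real.rpow_mul hδ.le, Real.rpow_two]
  rw [div_pow, mul_pow, hsq, le_div_iff₀ (by positivity), russmannFactor, Real.sq_sqrt (by
    have : 0 ≤ ∑ k ∈ smallIndices n L, b k := Finset.sum_nonneg fun k _ => hb0 k
    positivity), ← Finset.sum_filter_add_sum_filter_not s (fun k => l1 k ≤ L)]
  -- The factor 1/8 turns 2^n into 2^{n-3}, and 2^{2τ}/(4πδ)^{2τ} leaves (2π)^{-2τ} once δ^{2τ}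
  -- cancels.
  have h3 : (2 : ℝ) ^ ((n : ℤ) - 3) * hurwitz 2 (2 ^ τ) * (2 * Real.pi) ^ (-(2 * τ)) * J =
      2 ^ n * (γ ^ 2 * δ ^ (2 * τ)) * (1 / 8 * hurwitz 2 (2 ^ τ) * 2 ^ (2 * τ) /
        (4 * Real.pi * δ) ^ (2 * τ) / γ ^ 2 * J) := by
    have e1 : (2 : ℝ) ^ ((n : ℤ) - 3) = 2 ^ n * (1 / 8) := by
      rw [zpow_sub₀ two_ne_zero, zpow_natCast]; norm_num; ring
    have e2 : (4 * Real.pi * δ) ^ (2 * τ) =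
        2 ^ (2 * τ) * (2 * Real.pi) ^ (2 * τ) * δ ^ (2 * τ) := by
      rw [← Real.mul_rpow (by positivity) (by positivity),
        ← Real.mul_rpow (by positivity) (by positivity)]
      congr 1; ring
    rw [e1, e2, Real.rpow_neg (by positivity)]
    field_simp
  rw [h3]
  have h4 : 0 ≤ 2 ^ n * (γ ^ 2 * δ ^ (2 * τ)) := by positivity
  have h5 := mul_le_mul_of_nonneg_left (add_le_add h1 h2) h4
  refine le_trans (le_of_eq ?_) (h5.trans (le_of_eq ?_)) <;> ring

/-! ### Rüssmann's estimate. -/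

theorem norm_one_sub_expo (k : Fin n → ℤ) (ω : Fin n → ℝ) :
    ‖1 - expo k (fun i => (ω i : ℂ))‖ = 2 * |Real.sin (Real.pi * ∑ i, (k i : ℝ) * ω i)| := by
  have : expo k (fun i => (ω i : ℂ)) =
      Complex.exp (Complex.I * ((2 * (Real.pi * ∑ i, (k i : ℝ) * ω i) : ℝ) : ℂ)) := by
    rw [expo]
    congr 1
    push_cast
    ring
  rw [this, norm_sub_rev, Complex.norm_exp_I_mul_ofReal_sub_one, mul_div_cancel_left₀ _ two_ne_zero,
    norm_mul, Real.norm_eq_abs, Real.norm_eq_abs, abs_of_pos (two_pos (α := ℝ))]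

/-- Rüssmann's estimate, for finite partial sums. -/
theorem sum_norm_solTerm_le (hω : IsDiophantine γ τ ω) {R : ℝ} {u : (Fin n → ℂ) → ℂ}
    (hu : StripAnalytic R u) {δ ρ : ℝ} (hδ : 0 < δ) (hδρ : δ ≤ ρ) (hρ : ρ < R) (L : ℕ)
    {θ : Fin n → ℂ} (hθ : θ ∈ closedStrip n (ρ - δ)) (s : Finset (Fin n → ℤ)) :
    ∑ k ∈ s, ‖solTerm ω u θ k‖ ≤ russmannFactor L γ τ ω δ / (γ * δ ^ τ) * stripNorm ρ u := by
  have hγ := hω.1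
  have hρ0 : 0 ≤ ρ := hδ.le.trans hδρ
  have hc : 0 ≤ russmannFactor L γ τ ω δ / (γ * δ ^ τ) :=
    div_nonneg (Real.sqrt_nonneg _) (by positivity)
  set t := s.filter fun k => k ≠ 0 with ht
  have h1 : ∑ k ∈ s, ‖solTerm ω u θ k‖ ≤
      ∑ k ∈ t, (‖fourierCoef u k‖ * Real.exp (2 * Real.pi * ρ * l1 k)) *
        (Real.exp (-(2 * Real.pi * δ * l1 k)) /
          (2 * |Real.sin (Real.pi * ∑ i, (k i : ℝ) * ω i)|)) := by
    rw [ht, Finset.sum_filter]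
    refine Finset.sum_le_sum fun k _ => ?_
    by_cases hk : k = 0
    · simp [solTerm, hk]
    · rw [if_pos hk, solTerm, if_neg hk, norm_mul, norm_div, norm_one_sub_expo]
      have := norm_expo_le k hθ
      have h2 : Real.exp (2 * Real.pi * (ρ - δ) * l1 k) =
          Real.exp (2 * Real.pi * ρ * l1 k) * Real.exp (-(2 * Real.pi * δ * l1 k)) := by
        rw [← Real.exp_add]; congr 1; ring
      rw [h2] at this
      refine (mul_le_mul_of_nonneg_left this (by positivity)).trans_eq ?_
      ring
  refine h1.trans ?_
  refine le_of_sq_le_sq ?_ (mul_nonneg hc (stripNorm_nonneg _ _))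
  -- Cauchy–Schwarz: the coefficients keep the full weight of width ρ, while the divisors receive
  -- the decay gained from the loss δ.
  refine (Finset.sum_mul_sq_le_sq_mul_sq _ _ _).trans ?_
  have h3 := hu.sum_sq_fourierCoef_le hρ0 hρ t
  have h4 := hω.sum_divisors_le_russmannFactor hδ L t fun k hk => (Finset.mem_filter.1 hk).2
  have h5 : ∑ k ∈ t, (Real.exp (-(2 * Real.pi * δ * l1 k)) /
          (2 * |Real.sin (Real.pi * ∑ i, (k i : ℝ) * ω i)|)) ^ 2 =
      ∑ k ∈ t, Real.exp (-(4 * Real.pi * l1 k * δ)) /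
        (4 * |Real.sin (Real.pi * ∑ i, (k i : ℝ) * ω i)| ^ 2) := by
    refine Finset.sum_congr rfl fun k _ => ?_
    rw [div_pow, mul_pow, ← Real.exp_nat_mul]
    congr 1
    · congr 1; push_cast; ring
    · norm_num
  rw [h5]
  set B := ∑ k ∈ t, Real.exp (-(4 * Real.pi * l1 k * δ)) /
        (4 * |Real.sin (Real.pi * ∑ i, (k i : ℝ) * ω i)| ^ 2) with hB
  have hB0 : 0 ≤ B := Finset.sum_nonneg fun k _ => by positivity
  calc _ ≤ 2 ^ n * stripNorm ρ u ^ 2 * B := mul_le_mul_of_nonneg_right h3 hB0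
    _ = 2 ^ n * B * stripNorm ρ u ^ 2 := by ring
    _ ≤ (russmannFactor L γ τ ω δ / (γ * δ ^ τ)) ^ 2 * stripNorm ρ u ^ 2 :=
        mul_le_mul_of_nonneg_right h4 (sq_nonneg _)
    _ = _ := by ring

theorem summable_solTerm (hω : IsDiophantine γ τ ω) {R : ℝ} {u : (Fin n → ℂ) → ℂ}
    (hu : StripAnalytic R u) {δ ρ : ℝ} (hδ : 0 < δ) (hδρ : δ ≤ ρ) (hρ : ρ < R)
    {θ : Fin n → ℂ} (hθ : θ ∈ closedStrip n (ρ - δ)) : Summable (solTerm ω u θ) :=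
  Summable.of_norm (summable_of_sum_le (fun _ => norm_nonneg _)
    -- Any L serves for summability; 0 is an arbitrary choice.
    fun s => hω.sum_norm_solTerm_le hu hδ hδρ hρ 0 hθ s)

/-- Rüssmann's estimate. -/
theorem norm_solOp_le (hω : IsDiophantine γ τ ω) {R : ℝ} {u : (Fin n → ℂ) → ℂ}
    (hu : StripAnalytic R u) {δ ρ : ℝ} (hδ : 0 < δ) (hδρ : δ ≤ ρ) (hρ : ρ < R) (L : ℕ)
    {θ : Fin n → ℂ} (hθ : θ ∈ closedStrip n (ρ - δ)) :
    ‖solOp ω u θ‖ ≤ russmannFactor L γ τ ω δ / (γ * δ ^ τ) * stripNorm ρ u :=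
  (norm_tsum_le_tsum_norm (hω.summable_solTerm hu hδ hδρ hρ hθ).norm).trans
    (Real.tsum_le_of_sum_le (fun _ => norm_nonneg _)
      fun s => hω.sum_norm_solTerm_le hu hδ hδρ hρ L hθ s)

end IsDiophantine

/-! ### The discrete Fourier transform -/

/-- The integers `a` with `-M / 2 ≤ a < M / 2`. -/
def grid (M : ℕ) : Finset ℤ :=
  (Finset.Icc (-(M : ℤ)) M).filter fun a => -(M : ℤ) ≤ 2 * a ∧ 2 * a < M

theorem mem_grid {M : ℕ} {a : ℤ} : a ∈ grid M ↔ -(M : ℤ) ≤ 2 * a ∧ 2 * a < M := by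
  simp only [grid, Finset.mem_filter, Finset.mem_Icc]
  omega

theorem gridIndices_eq (N : Fin n → ℕ) : gridIndices N = Fintype.piFinset fun i => grid (N i) := rfl

theorem bmod_mem_grid {M : ℕ} (hM : 0 < M) (a : ℤ) : a.bmod M ∈ grid M := by
  rw [mem_grid]
  have h1 := Int.le_bmod (x := a) hM
  have h2 := Int.bmod_lt (x := a) hM
  omega

theorem bmod_of_mem_grid {M : ℕ} {a : ℤ} (ha : a ∈ grid M) : a.bmod M = a := by
  rw [mem_grid] at ha
  apply Int.bmod_eq_of_le <;> omega

theorem exists_bmod_eq (M : ℕ) (a : ℤ) : ∃ m : ℤ, a = a.bmod M + M * m :=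
  ⟨a.bdiv M, (Int.bmod_add_bdiv a M).symm⟩

/-- The representatives modulo `N` in the symmetric range. -/
def reduce (N : Fin n → ℕ) (k : Fin n → ℤ) : Fin n → ℤ := fun i => (k i).bmod (N i)

theorem reduce_mem {N : Fin n → ℕ} (hN : ∀ i, 0 < N i) (k : Fin n → ℤ) :
    reduce N k ∈ gridIndices N := by
  rw [gridIndices_eq, Fintype.mem_piFinset]
  exact fun i => bmod_mem_grid (hN i) _

theorem reduce_of_mem {N : Fin n → ℕ} {k : Fin n → ℤ} (hk : k ∈ gridIndices N) :
    reduce N k = k := by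
  rw [gridIndices_eq, Fintype.mem_piFinset] at hk
  exact funext fun i => bmod_of_mem_grid (hk i)

/-- The grid point `(j_1 / N_1, …, j_n / N_n)`. -/
def gridPoint (N : Fin n → ℕ) (j : Fin n → ℕ) : Fin n → ℂ := fun i => (j i : ℂ) / (N i : ℂ)

theorem sum_root_of_unity {M : ℕ} (hM : 0 < M) (a : ℤ) :
    ∑ j ∈ Finset.range M, Complex.exp (2 * Real.pi * Complex.I * (a * ((j : ℂ) / (M : ℂ)))) =
      if (M : ℤ) ∣ a then (M : ℂ) else 0 := by
  have hM' : (M : ℂ) ≠ 0 := by exact_mod_cast hM.ne'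
  set z := Complex.exp (2 * Real.pi * Complex.I * (a / M)) with hz
  have h1 : ∀ j : ℕ, Complex.exp (2 * Real.pi * Complex.I * (a * ((j : ℂ) / (M : ℂ)))) = z ^ j := by
    intro j
    rw [hz, ← Complex.exp_nat_mul]
    congr 1
    ring
  have hz1 : z = 1 ↔ (M : ℤ) ∣ a := by
    rw [hz, Complex.exp_eq_one_iff]
    have h2 : (2 * Real.pi * Complex.I : ℂ) ≠ 0 := Complex.two_pi_I_ne_zero
    constructor
    · rintro ⟨m, hm⟩
      refine ⟨m, ?_⟩
      rw [mul_comm (m : ℂ)] at hm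
      have h3 := mul_left_cancel₀ h2 hm
      rw [div_eq_iff hM'] at h3
      rw [mul_comm]
      exact_mod_cast h3
    · rintro ⟨m, rfl⟩
      refine ⟨m, ?_⟩
      push_cast
      field_simp
  have hzM : z ^ M = 1 := by
    rw [hz, ← Complex.exp_nat_mul, Complex.exp_eq_one_iff]
    refine ⟨a, ?_⟩
    field_simp
  simp only [h1]
  split_ifs with h
  · simp [hz1.2 h]
  · rw [geom_sum_eq (fun h' => h (hz1.1 h')), hzM]
    simp

theorem expo_eq_prod (k : Fin n → ℤ) (θ : Fin n → ℂ) :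
    expo k θ = ∏ i, Complex.exp (2 * Real.pi * Complex.I * (k i * θ i)) := by
  rw [expo, Finset.mul_sum, Complex.exp_sum]

theorem dftCoef_eq (N : Fin n → ℕ) (u : (Fin n → ℂ) → ℂ) (k : Fin n → ℤ) :
    dftCoef N u k = 1 / (∏ i, (N i : ℂ)) * ∑ j ∈ Fintype.piFinset fun i => Finset.range (N i),
      u (gridPoint N j) * expo (-k) (gridPoint N j) := by
  simp only [dftCoef, expo_neg]
  rfl

/-- Orthogonality of roots of unity in each coordinate: on the grid points a mode is
indistinguishable from its representative modulo N. -/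
theorem dftCoef_expo {N : Fin n → ℕ} (hN : ∀ i, 0 < N i) (l : Fin n → ℤ) {k : Fin n → ℤ}
    (hk : k ∈ gridIndices N) : dftCoef N (expo l) k = if reduce N l = k then 1 else 0 := by
  have h1 : ∑ j ∈ Fintype.piFinset fun i => Finset.range (N i),
      expo l (gridPoint N j) * expo (-k) (gridPoint N j) =
      ∏ i, if (N i : ℤ) ∣ l i - k i then (N i : ℂ) else 0 := by
    have h0 : ∀ j, expo l (gridPoint N j) * expo (-k) (gridPoint N j) = ∏ i,
        Complex.exp (2 * Real.pi * Complex.I * (((l + -k) i : ℤ) * ((j i : ℂ) / (N i : ℂ)))) :=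
      fun j => by rw [← expo_add, expo_eq_prod]; rfl
    simp only [h0]
    rw [← Finset.prod_univ_sum (fun i => Finset.range (N i)) (fun i j =>
      Complex.exp (2 * Real.pi * Complex.I * (((l + -k) i : ℤ) * ((j : ℂ) / (N i : ℂ)))))]
    exact Finset.prod_congr rfl fun i _ => by
      rw [sum_root_of_unity (hN i)]
      simp [sub_eq_add_neg]
  have h2 : ∀ i, (N i : ℤ) ∣ l i - k i ↔ reduce N l i = k i := by
    intro i
    rw [gridIndices_eq, Fintype.mem_piFinset] at hk
    rw [reduce, ← bmod_of_mem_grid (hk i), Int.bmod_eq_bmod_iff_bmod_sub_eq_zero,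
      ← Int.dvd_iff_bmod_eq_zero, bmod_of_mem_grid (hk i)]
  rw [dftCoef_eq, h1]
  simp only [h2]
  split_ifs with h
  · simp only [h, if_true]
    refine one_div_mul_cancel (Finset.prod_ne_zero_iff.2 fun i _ => ?_)
    exact_mod_cast (hN i).ne'
  · obtain ⟨i, hi⟩ := Function.ne_iff.1 h
    exact mul_eq_zero_of_right _ (Finset.prod_eq_zero (Finset.mem_univ i) (if_neg hi))

theorem gridPoint_mem_strip {R : ℝ} (hR : 0 < R) (N j : Fin n → ℕ) : gridPoint N j ∈ strip n R := by
  intro i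
  have : gridPoint N j i = ((j i / N i : ℝ) : ℂ) := by simp [gridPoint]
  rw [this, Complex.ofReal_im, abs_zero]
  exact hR

namespace StripAnalytic

variable {R : ℝ} {u : (Fin n → ℂ) → ℂ}

/-- The discrete Fourier approximation is obtained by aliasing. -/
theorem hasSum_dftApprox (hu : StripAnalytic R u) (hR : 0 < R) {N : Fin n → ℕ}
    (hN : ∀ i, 0 < N i) (θ : Fin n → ℂ) :
    HasSum (fun l => fourierCoef u l * expo (reduce N l) θ) (dftApprox N u θ) := by
  have h1 : ∀ k ∈ gridIndices N, HasSum (fun l => fourierCoef u l * dftCoef N (expo l) k * expo k θ)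
      (dftCoef N u k * expo k θ) := by
    intro k _
    refine HasSum.mul_right _ ?_
    simp only [dftCoef_eq]
    -- The Fourier series of u is inserted at the finitely many grid points.
    have h2 := (hasSum_sum fun j (_ : j ∈ Fintype.piFinset fun i => Finset.range (N i)) =>
      (hu.hasSum_fourier (gridPoint_mem_strip hR N j) hR).mul_right
        (expo (-k) (gridPoint N j))).mul_left (1 / (∏ i, (N i : ℂ)))
    refine h2.congr_fun fun l => ?_
    rw [mul_left_comm, Finset.mul_sum]
    simp only [mul_assoc]
  refine (hasSum_sum h1).congr_fun fun l => ?_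
  rw [Finset.sum_eq_single_of_mem (reduce N l) (reduce_mem hN l)]
  · rw [dftCoef_expo hN l (reduce_mem hN l), if_pos rfl, mul_one]
  · intro k hk hne
    rw [dftCoef_expo hN l hk, if_neg hne.symm, mul_zero, zero_mul]

end StripAnalytic

theorem stripAnalytic_dftApprox (R : ℝ) (N : Fin n → ℕ) (u : (Fin n → ℂ) → ℂ) :
    StripAnalytic R (dftApprox N u) :=
  stripAnalytic_finsetSum _ fun k _ => (stripAnalytic_const R _).mul (stripAnalytic_expo R k)

/-! ### The error constant -/

theorem grid_zero : grid 0 = ∅ := by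
  ext a
  simp only [mem_grid, Finset.notMem_empty, iff_false]
  omega

/-- The half-open range grows alternately on the right, by p, and on the left, by -(p + 1); hence
the induction over pairs in `sum_grid_exp`. -/
theorem sum_grid_even_succ (p : ℕ) (f : ℤ → ℝ) :
    ∑ a ∈ grid (2 * p + 1), f a = ∑ a ∈ grid (2 * p), f a + f p := by
  have : grid (2 * p + 1) = insert (p : ℤ) (grid (2 * p)) := by
    ext a
    simp only [Finset.mem_insert, mem_grid]
    omega
  rw [this, Finset.sum_insert (by simp only [mem_grid]; omega), add_comm]

theorem sum_grid_odd_succ (p : ℕ) (f : ℤ → ℝ) :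
    ∑ a ∈ grid (2 * p + 2), f a = ∑ a ∈ grid (2 * p + 1), f a + f (-(p + 1)) := by
  have : grid (2 * p + 2) = insert (-(p + 1) : ℤ) (grid (2 * p + 1)) := by
    ext a
    simp only [Finset.mem_insert, mem_grid]
    omega
  rw [this, Finset.sum_insert (by simp only [mem_grid]; omega), add_comm]

/-- A finite geometric sum; μ_M accounts for the unpaired endpoint. Negative δ is allowed because
`hasSum_exp_bmod` needs the value at -ρ' - ρ. -/
theorem sum_grid_exp (M : ℕ) {δ : ℝ} (hδ : δ ≠ 0) :
    ∑ a ∈ grid M, Real.exp (-(2 * Real.pi * δ * |(a : ℝ)|)) = dftNu M δ := by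
  set q := Real.exp (-(2 * Real.pi * δ)) with hq
  have hq0 : 0 < q := Real.exp_pos _
  have hq1 : q ≠ 1 := by
    rw [hq, Ne, Real.exp_eq_one_iff]
    simp [hδ, Real.pi_ne_zero]
  have hq1' : 1 - q ≠ 0 := sub_ne_zero.2 hq1.symm
  have hpow : ∀ p : ℕ, Real.exp (-(2 * Real.pi * δ * |((p : ℤ) : ℝ)|)) = q ^ p := by
    intro p
    rw [hq, ← Real.exp_nat_mul, Int.cast_natCast, Nat.abs_cast]
    congr 1
    ring
  have hpow' : ∀ p : ℕ, Real.exp (-(2 * Real.pi * δ * |((-(p + 1) : ℤ) : ℝ)|)) = q ^ (p + 1) := by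
    intro p
    rw [← hpow (p + 1), Int.cast_neg, abs_neg, Nat.cast_succ]
  have heven : ∀ p : ℕ, ∑ a ∈ grid (2 * p), Real.exp (-(2 * Real.pi * δ * |(a : ℝ)|)) =
      (1 + q) * (1 - q ^ p) / (1 - q) := by
    intro p
    induction p with
    | zero => simp [grid_zero]
    | succ p ih =>
      rw [mul_add, mul_one, sum_grid_odd_succ, sum_grid_even_succ, ih, hpow, hpow']
      field_simp
      ring
  have hexp : Real.exp (2 * Real.pi * δ) = q⁻¹ := by rw [hq, Real.exp_neg, inv_inv]
  have hfac : (q⁻¹ + 1) / (q⁻¹ - 1) = (1 + q) / (1 - q) := by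
    rw [← mul_div_mul_left _ _ hq0.ne', mul_add, mul_sub, mul_inv_cancel₀ hq0.ne', mul_one]
  rw [dftNu, dftMu, hexp, hfac]
  obtain ⟨p, rfl | rfl⟩ := Nat.even_or_odd' M
  · have : Real.exp (-(Real.pi * δ * (2 * p : ℕ))) = q ^ p := by
      rw [hq, ← Real.exp_nat_mul]; congr 1; push_cast; ring
    rw [heven, if_pos (even_two_mul p), this]
    ring
  · have h1 : Real.exp (Real.pi * δ) * Real.exp (-(Real.pi * δ * (2 * p + 1 : ℕ))) = q ^ p := by
      rw [hq, ← Real.exp_nat_mul, ← Real.exp_add]; congr 1; push_cast; ring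
    have h4 : 2 * Real.exp (Real.pi * δ) / (q⁻¹ + 1) *
        Real.exp (-(Real.pi * δ * (2 * p + 1 : ℕ))) = 2 * q ^ p / (q⁻¹ + 1) := by
      rw [← h1]; ring
    rw [sum_grid_even_succ, heven, hpow, if_neg (by simp), h4]
    have h2 : q⁻¹ + 1 ≠ 0 := by positivity
    have h3 : 1 + q ≠ 0 := by positivity
    field_simp
    ring

/-- The sum of `e^{-c|a|}` over a residue class modulo `M`. -/
theorem hasSum_exp_residue {c : ℝ} (hc : 0 < c) {M : ℕ} (hM : 0 < M) {k : ℤ} (hk : k ∈ grid M) :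
    HasSum (fun m : ℤ => Real.exp (-(c * |((k + M * m : ℤ) : ℝ)|)))
      (1 / (1 - Real.exp (-(c * M))) * (Real.exp (-(c * |(k : ℝ)|)) +
        Real.exp (-(c * M)) * Real.exp (c * |(k : ℝ)|))) := by
  set r := Real.exp (-(c * M)) with hr
  have hM' : (0 : ℝ) < M := by exact_mod_cast hM
  have hr1 : r < 1 := by rw [hr, Real.exp_lt_one_iff, neg_lt_zero]; positivity
  have hr0 : 0 < r := Real.exp_pos _
  rw [mem_grid] at hk
  have hk1 : -(M : ℝ) ≤ 2 * k := by exact_mod_cast hk.1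
  have hk2 : 2 * (k : ℝ) ≤ M := by exact_mod_cast hk.2.le
  -- One half of the residue class. The other half is the same statement at -k, and |x| ≤ M removes
  -- the absolute value.
  have key : ∀ x : ℝ, |x| ≤ M → HasSum (fun j : ℕ => Real.exp (-(c * |x + M * (j + 1)|)))
      (r * Real.exp (-(c * x)) * (1 - r)⁻¹) := by
    intro x hx
    refine ((hasSum_geometric_of_lt_one hr0.le hr1).mul_left (r * Real.exp (-(c * x)))).congr_fun
      fun j => ?_
    have h1 : 0 ≤ x + M * (j + 1) := by
      have := (abs_le.1 hx).1
      nlinarith [mul_nonneg hM'.le (Nat.cast_nonneg (α := ℝ) j)]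
    rw [abs_of_nonneg h1, hr, ← Real.exp_nat_mul, ← Real.exp_add, ← Real.exp_add]
    congr 1
    ring
  have hkM : |(k : ℝ)| ≤ M := abs_le.2 ⟨by linarith, by linarith⟩
  have h1 := key k hkM
  have h2 := key (-k) (by rwa [abs_neg])
  have h3 := hasSum_int_of_pos_of_neg
    (f := fun m : ℤ => Real.exp (-(c * |((k + M * m : ℤ) : ℝ)|)))
    (a := r * Real.exp (-(c * k)) * (1 - r)⁻¹) (b := r * Real.exp (-(c * -k)) * (1 - r)⁻¹)
    (by simpa using h1) (by
      refine h2.congr_fun fun j => ?_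
      rw [← abs_neg]
      congr 4
      push_cast
      ring)
  convert h3 using 1
  have h4 : 1 - r ≠ 0 := by linarith
  simp only [mul_zero, add_zero, mul_neg, neg_neg]
  rcases abs_choice (k : ℝ) with h | h <;> rw [h] <;> try simp only [mul_neg, neg_neg]
  all_goals
    field_simp
    ring

/-- Sort the integers by residue: the second factor is constant on each class, and the class sums of
`hasSum_exp_residue` add up over the grid to values of ν_M. -/
theorem hasSum_exp_bmod {ρ ρ' : ℝ} (h0 : 0 ≤ ρ) (h : ρ < ρ') {M : ℕ} (hM : 0 < M) :
    HasSum (fun a : ℤ => Real.exp (-(2 * Real.pi * ρ' * |(a : ℝ)|)) *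
        Real.exp (2 * Real.pi * ρ * |((a.bmod M : ℤ) : ℝ)|))
      (1 / (1 - Real.exp (-(2 * Real.pi * ρ' * M))) *
        (dftNu M (ρ' - ρ) + Real.exp (-(2 * Real.pi * ρ' * M)) * dftNu M (-ρ' - ρ))) := by
  have hc : 0 < 2 * Real.pi * ρ' := by have := h0.trans_lt h; positivity
  have h1 : ∀ k ∈ grid M, HasSum (fun a : ℤ => if a.bmod M = k then
      Real.exp (-(2 * Real.pi * ρ' * |(a : ℝ)|)) * Real.exp (2 * Real.pi * ρ * |(k : ℝ)|) else 0)
      (1 / (1 - Real.exp (-(2 * Real.pi * ρ' * M))) * (Real.exp (-(2 * Real.pi * ρ' * |(k : ℝ)|)) +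
        Real.exp (-(2 * Real.pi * ρ' * M)) * Real.exp (2 * Real.pi * ρ' * |(k : ℝ)|)) *
        Real.exp (2 * Real.pi * ρ * |(k : ℝ)|)) := by
    intro k hk
    have hinj : Function.Injective fun m : ℤ => k + M * m := fun a b hab => by
      simpa [hM.ne'] using hab
    refine (hinj.hasSum_iff fun a ha => if_neg fun hak => ha ?_).1 ?_
    · obtain ⟨m, hm⟩ := exists_bmod_eq M a
      exact ⟨m, by simp only; rw [hm, hak]⟩
    · refine ((hasSum_exp_residue hc hM hk).mul_right _).congr_fun fun m => ?_
      rw [Function.comp_apply, if_pos]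
      rw [Int.add_mul_bmod_self_left, bmod_of_mem_grid hk]
  convert hasSum_sum h1 using 1
  · ext a
    rw [Finset.sum_ite_eq, if_pos (bmod_mem_grid hM a)]
  · rw [← sum_grid_exp M (sub_pos.2 h).ne', ← sum_grid_exp M (by linarith : (-ρ' - ρ) ≠ 0),
      Finset.mul_sum, ← Finset.sum_add_distrib, Finset.mul_sum]
    refine Finset.sum_congr rfl fun k _ => ?_
    have e1 : Real.exp (-(2 * Real.pi * (ρ' - ρ) * |(k : ℝ)|)) =
        Real.exp (-(2 * Real.pi * ρ' * |(k : ℝ)|)) * Real.exp (2 * Real.pi * ρ * |(k : ℝ)|) := by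
      rw [← Real.exp_add]; congr 1; ring
    have e2 : Real.exp (-(2 * Real.pi * (-ρ' - ρ) * |(k : ℝ)|)) =
        Real.exp (2 * Real.pi * ρ' * |(k : ℝ)|) * Real.exp (2 * Real.pi * ρ * |(k : ℝ)|) := by
      rw [← Real.exp_add]; congr 1; ring
    rw [e1, e2]
    ring

theorem one_sub_exp_ne_zero {c : ℝ} (hc : 0 < c) {M : ℕ} (hM : 0 < M) :
    1 - Real.exp (-(c * M)) ≠ 0 := by
  have hM' : (0 : ℝ) < M := by exact_mod_cast hM
  have : Real.exp (-(c * M)) < 1 := by rw [Real.exp_lt_one_iff, neg_lt_zero]; positivity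
  linarith

/-- Expanding the product over sign vectors gives S^{*1} plus the term σ = (1,…,1). That term
exceeds S^{*2} by exactly the product of the ν's, because the prefactor P and the product D are
inverse to each other. -/
theorem dftS1_add_dftS2 {N : Fin n → ℕ} (hN : ∀ i, 0 < N i) {ρ ρ' : ℝ} (hρ' : 0 < ρ') :
    dftS1 N ρ ρ' + dftS2 N ρ ρ' =
      ∏ i, (1 / (1 - Real.exp (-(2 * Real.pi * ρ' * N i))) *
        (dftNu (N i) (ρ' - ρ) + Real.exp (-(2 * Real.pi * ρ' * N i)) * dftNu (N i) (-ρ' - ρ))) -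
      ∏ i, dftNu (N i) (ρ' - ρ) := by
  have hc : 0 < 2 * Real.pi * ρ' := by positivity
  set P := ∏ i, 1 / (1 - Real.exp (-(2 * Real.pi * ρ' * N i))) with hP
  set D := ∏ i, (1 - Real.exp (-(2 * Real.pi * ρ' * N i))) with hD
  have hPD : P * D = 1 := by
    rw [hP, hD, ← Finset.prod_mul_distrib]
    exact Finset.prod_eq_one fun i _ => one_div_mul_cancel (one_sub_exp_ne_zero hc (hN i))
  set f : Fin n → ℤ → ℝ := fun i s => Real.exp (((s : ℝ) - 1) * Real.pi * ρ' * N i) *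
    dftNu (N i) ((s : ℝ) * ρ' - ρ) with hf
  have h1 : ∑ σ ∈ (Fintype.piFinset fun _ : Fin n => ({-1, 1} : Finset ℤ)).filter fun σ => σ ≠ 1,
      ∏ i, f i (σ i) = ∏ i, (f i (-1) + f i 1) - ∏ i, f i 1 := by
    have h2 : ∏ i, (f i (-1) + f i 1) =
        ∑ σ ∈ Fintype.piFinset fun _ : Fin n => ({-1, 1} : Finset ℤ), ∏ i, f i (σ i) := by
      rw [← Finset.prod_univ_sum]
      exact Finset.prod_congr rfl fun i _ => by rw [Finset.sum_pair (by norm_num)]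
    rw [h2, ← Finset.sum_filter_add_sum_filter_not
      (Fintype.piFinset fun _ : Fin n => ({-1, 1} : Finset ℤ)) (fun σ => σ ≠ 1), add_sub_assoc]
    have h3 : ((Fintype.piFinset fun _ : Fin n => ({-1, 1} : Finset ℤ)).filter
        fun σ => ¬ σ ≠ 1) = {1} := by
      ext σ
      simp only [not_not, Finset.mem_filter, Fintype.mem_piFinset, Finset.mem_singleton,
        and_iff_right_iff_imp]
      rintro rfl i
      simp
    rw [h3, Finset.sum_singleton]
    simp
  have hf1 : ∀ i, f i 1 = dftNu (N i) (ρ' - ρ) := fun i => by simp [hf]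
  have hf2 : ∀ i, f i (-1) = Real.exp (-(2 * Real.pi * ρ' * N i)) * dftNu (N i) (-ρ' - ρ) := by
    intro i
    simp only [hf]
    push_cast
    congr 2 <;> ring
  have hS1 : dftS1 N ρ ρ' = P * (∏ i, (f i (-1) + f i 1) - ∏ i, f i 1) := by rw [← h1]; rfl
  have hS2 : dftS2 N ρ ρ' = P * (1 - D) * ∏ i, dftNu (N i) (ρ' - ρ) := rfl
  simp only [hS1, hS2, hf1, hf2, add_comm (dftNu _ _)]
  rw [Finset.prod_mul_distrib, ← hP]
  linear_combination (-(∏ i, dftNu (N i) (ρ' - ρ))) * hPD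

/-- T_N is the sum of e^{-2π(ρ'-ρ)|k|} over the whole lattice minus its sum over the grid. -/
theorem dftT_eq (N : Fin n → ℕ) (ρ ρ' : ℝ) :
    dftT N ρ ρ' = ((Real.exp (2 * Real.pi * (ρ' - ρ)) + 1) /
      (Real.exp (2 * Real.pi * (ρ' - ρ)) - 1)) ^ n - ∏ i, dftNu (N i) (ρ' - ρ) := by
  simp only [dftT, dftNu, Finset.prod_mul_distrib, Finset.prod_const, Finset.card_univ,
    Fintype.card_fin]
  ring

/-- The error constant is a sum over the multi-indices off the grid. -/
theorem hasSum_dftConst {N : Fin n → ℕ} (hN : ∀ i, 0 < N i) {ρ ρ' : ℝ} (h0 : 0 ≤ ρ) (h : ρ < ρ') :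
    HasSum (fun k : Fin n → ℤ => if k ∈ gridIndices N then 0 else
      Real.exp (-(2 * Real.pi * ρ' * l1 k)) * (Real.exp (2 * Real.pi * ρ * l1 k) +
        Real.exp (2 * Real.pi * ρ * l1 (reduce N k)))) (dftConst N ρ ρ') := by
  have hδ : 0 < ρ' - ρ := sub_pos.2 h
  have e1 : ∀ k : Fin n → ℤ, Real.exp (-(2 * Real.pi * ρ' * l1 k)) *
      Real.exp (2 * Real.pi * ρ * l1 k) = Real.exp (-(2 * Real.pi * (ρ' - ρ) * l1 k)) := by
    intro k
    rw [← Real.exp_add]; congr 1; ring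
  have h1 := hasSum_exp_l1 (n := n) hδ
  have h2 : HasSum (fun k : Fin n → ℤ => Real.exp (-(2 * Real.pi * ρ' * l1 k)) *
      Real.exp (2 * Real.pi * ρ * l1 (reduce N k))) (∏ i, (1 / (1 - Real.exp (-(2 * Real.pi * ρ' *
        N i))) * (dftNu (N i) (ρ' - ρ) + Real.exp (-(2 * Real.pi * ρ' * N i)) *
          dftNu (N i) (-ρ' - ρ)))) := by
    refine (hasSum_prod_pi (fun i m => ?_) fun i => hasSum_exp_bmod h0 h (hN i)).congr_fun
      fun k => ?_
    · positivity
    · rw [Finset.prod_mul_distrib, exp_l1, l1_cast, Finset.mul_sum, Real.exp_sum]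
      rfl
  -- On the grid `reduce` is the identity, so both full sums contribute the same term there; hence
  -- the 2.
  have h3 : HasSum (fun k : Fin n → ℤ => if k ∈ gridIndices N then
      2 * Real.exp (-(2 * Real.pi * (ρ' - ρ) * l1 k)) else 0)
      (2 * ∏ i, dftNu (N i) (ρ' - ρ)) := by
    have h4 : ∏ i, dftNu (N i) (ρ' - ρ) =
        ∑ k ∈ gridIndices N, Real.exp (-(2 * Real.pi * (ρ' - ρ) * l1 k)) := by
      simp only [exp_l1, gridIndices_eq]
      rw [← Finset.prod_univ_sum (fun i => grid (N i))
        (fun _ a => Real.exp (-(2 * Real.pi * (ρ' - ρ) * |(a : ℝ)|)))]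
      exact Finset.prod_congr rfl fun i _ => (sum_grid_exp (N i) hδ.ne').symm
    rw [h4, Finset.mul_sum]
    rw [← Finset.sum_congr rfl fun k hk => if_pos hk]
    exact hasSum_sum_of_ne_finset_zero fun k hk => if_neg hk
  have h5 := (h1.add h2).sub h3
  have e2 : dftConst N ρ ρ' = ((Real.exp (2 * Real.pi * (ρ' - ρ)) + 1) /
      (Real.exp (2 * Real.pi * (ρ' - ρ)) - 1)) ^ n +
      ∏ i, (1 / (1 - Real.exp (-(2 * Real.pi * ρ' * N i))) *
        (dftNu (N i) (ρ' - ρ) + Real.exp (-(2 * Real.pi * ρ' * N i)) * dftNu (N i) (-ρ' - ρ))) -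
      2 * ∏ i, dftNu (N i) (ρ' - ρ) := by
    rw [dftConst, dftS1_add_dftS2 hN (h0.trans_lt h), dftT_eq]
    ring
  rw [e2]
  refine h5.congr_fun fun k => ?_
  split_ifs with hk
  · rw [reduce_of_mem hk, e1]
    ring
  · rw [mul_add, e1, sub_zero]

/-! ### Error of the approximation, and the corollary. -/

namespace StripAnalytic

variable {R : ℝ} {u : (Fin n → ℂ) → ℂ}

/-- The error of the discrete Fourier approximation. -/
theorem norm_sub_dftApprox_le (hu : StripAnalytic R u) {N : Fin n → ℕ} (hN : ∀ i, 0 < N i)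
    {ρ ρ' : ℝ} (h0 : 0 ≤ ρ) (h : ρ < ρ') (hR : ρ' < R) {θ : Fin n → ℂ}
    (hθ : θ ∈ closedStrip n ρ) :
    ‖u θ - dftApprox N u θ‖ ≤ dftConst N ρ ρ' * stripNorm ρ' u := by
  have hR0 : 0 < R := h0.trans_lt (h.trans hR)
  refine ((hu.hasSum_fourier (closedStrip_subset_strip (h.trans hR) hθ) hR0).sub
    (hu.hasSum_dftApprox hR0 hN θ)).norm_le_of_bounded
    ((hasSum_dftConst hN h0 h).mul_right (stripNorm ρ' u)) fun k => ?_
  split_ifs with hk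
  · simp [reduce_of_mem hk]
  · rw [← mul_sub, norm_mul]
    calc ‖fourierCoef u k‖ * ‖expo k θ - expo (reduce N k) θ‖
        ≤ (stripNorm ρ' u * Real.exp (-(2 * Real.pi * ρ' * l1 k))) *
          (Real.exp (2 * Real.pi * ρ * l1 k) + Real.exp (2 * Real.pi * ρ * l1 (reduce N k))) :=
          mul_le_mul (hu.norm_fourierCoef_le (h0.trans h.le) hR k)
            ((norm_sub_le _ _).trans (add_le_add (norm_expo_le k hθ) (norm_expo_le _ hθ)))
            (norm_nonneg _) (mul_nonneg (stripNorm_nonneg _ _) (Real.exp_pos _).le)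
      _ = _ := by ring

theorem fourierCoef_sub {w : (Fin n → ℂ) → ℂ} (hu : StripAnalytic R u) (hw : StripAnalytic R w)
    (hR : 0 < R) (k : Fin n → ℤ) :
    fourierCoef (fun θ => u θ - w θ) k = fourierCoef u k - fourierCoef w k := by
  have hint : ∀ {f : (Fin n → ℂ) → ℂ}, StripAnalytic R f →
      IntegrableOn (fun x : Fin n → ℝ => f (fun i => (x i : ℂ)) * expo (-k) (fun i => (x i : ℂ)))
        (Set.Icc 0 1) := by
    intro f hf
    have := (hf.mul (stripAnalytic_expo R (-k))).continuous_shift (η := 0) (fun i => by simpa using hR)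
    simp only [shift_zero] at this
    exact this.continuousOn.integrableOn_compact isCompact_Icc
  simp only [fourierCoef_eq, sub_mul]
  exact integral_sub (hint hu) (hint hw)

/-- If the norm vanished on the smaller strip, all Fourier coefficients would vanish, and the
Fourier series would make u zero on the whole strip. -/
theorem stripNorm_pos (hu : StripAnalytic R u) {ρ : ℝ} (h0 : 0 < ρ) (hρ : ρ < R)
    (hne : ∃ θ ∈ strip n R, u θ ≠ 0) : 0 < stripNorm ρ u := by
  refine (stripNorm_nonneg ρ u).lt_of_ne' fun hzero => ?_
  obtain ⟨θ, hθ, hθ0⟩ := hne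
  refine hθ0 ?_
  have h1 := hu.hasSum_fourier hθ (h0.trans hρ)
  have h2 : ∀ k, fourierCoef u k = 0 := fun k => by
    have := hu.norm_fourierCoef_le h0.le hρ k
    rwa [hzero, zero_mul, norm_le_zero_iff] at this
  simp only [h2, zero_mul] at h1
  exact h1.unique hasSum_zero

end StripAnalytic

theorem IsDiophantine.solOp_sub {γ τ : ℝ} {ω : Fin n → ℝ} (hω : IsDiophantine γ τ ω) {R : ℝ}
    {u w : (Fin n → ℂ) → ℂ} (hu : StripAnalytic R u) (hw : StripAnalytic R w) {δ ρ : ℝ}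
    (hδ : 0 < δ) (hδρ : δ ≤ ρ) (hρ : ρ < R) {θ : Fin n → ℂ} (hθ : θ ∈ closedStrip n (ρ - δ)) :
    solOp ω (fun θ => u θ - w θ) θ = solOp ω u θ - solOp ω w θ := by
  unfold solOp
  rw [← (hω.summable_solTerm hu hδ hδρ hρ hθ).tsum_sub (hω.summable_solTerm hw hδ hδρ hρ hθ)]
  congr 1
  ext k
  simp only [solTerm, hu.fourierCoef_sub hw ((hδ.trans_le hδρ).trans hρ)]
  split_ifs <;> ring

end CohomEq

end

theorem mainTheorem1 (n : ℕ) (γ τ : ℝ) (ω : Fin n → ℝ) (hω : CohomEq.IsDiophantine γ τ ω)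
    (ρhat : ℝ) (v : (Fin n → ℂ) → ℂ)
    (hv : AnalyticOnNhd ℂ v (CohomEq.strip n ρhat))
    (hper : CohomEq.PeriodicOnStrip ρhat v)
    (hne : ∃ θ ∈ CohomEq.strip n ρhat, v θ ≠ 0)
    (L : ℕ) (N : Fin n → ℕ) (hN : ∀ i, 0 < N i)
    (δ ρ ρt : ℝ) (hδ : 0 < δ) (hδρ : δ ≤ ρ) (hρ : ρ < ρt) (hρt : ρt < ρhat) :
    (∀ θ ∈ CohomEq.closedStrip n (ρ - δ), Summable (CohomEq.solTerm ω v θ)) ∧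
    BddAbove ((fun θ => ‖CohomEq.solOp ω v θ‖) '' CohomEq.closedStrip n (ρ - δ)) ∧
    0 < CohomEq.stripNorm ρ v ∧
    (CohomEq.stripNorm (ρ - δ) (CohomEq.solOp ω (CohomEq.dftApprox N v))
        - CohomEq.russmannFactor L γ τ ω δ * CohomEq.dftConst N ρ ρt / (γ * δ ^ τ)
          * CohomEq.stripNorm ρt v)
      / (CohomEq.stripNorm ρ (CohomEq.dftApprox N v)
          + CohomEq.dftConst N ρ ρt * CohomEq.stripNorm ρt v)
      ≤ CohomEq.ratioF ρ δ ω v ∧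
    (0 < CohomEq.stripNorm ρ (CohomEq.dftApprox N v)
          - CohomEq.dftConst N ρ ρt * CohomEq.stripNorm ρt v →
      CohomEq.ratioF ρ δ ω v ≤
        (CohomEq.stripNorm (ρ - δ) (CohomEq.solOp ω (CohomEq.dftApprox N v))
            + CohomEq.russmannFactor L γ τ ω δ * CohomEq.dftConst N ρ ρt / (γ * δ ^ τ)
              * CohomEq.stripNorm ρt v)
          / (CohomEq.stripNorm ρ (CohomEq.dftApprox N v)
              - CohomEq.dftConst N ρ ρt * CohomEq.stripNorm ρt v)) := by
  open CohomEq in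
  have hV : StripAnalytic ρhat v := ⟨hv, hper⟩
  have hW : StripAnalytic ρhat (dftApprox N v) := stripAnalytic_dftApprox ρhat N v
  have hρ0 : 0 < ρ := hδ.trans_le hδρ
  have hρR : ρ < ρhat := hρ.trans hρt
  have hγ := hω.1
  set E := dftConst N ρ ρt * stripNorm ρt v with hE
  set K := russmannFactor L γ τ ω δ / (γ * δ ^ τ) with hK
  have hK0 : 0 ≤ K := div_nonneg (Real.sqrt_nonneg _) (by positivity)
  have hKE : russmannFactor L γ τ ω δ * dftConst N ρ ρt / (γ * δ ^ τ) * stripNorm ρt v = K * E := by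
    rw [hK, hE]; ring
  have hdiff : ∀ θ ∈ closedStrip n ρ, ‖v θ - dftApprox N v θ‖ ≤ E :=
    fun θ hθ => hV.norm_sub_dftApprox_le hN hρ0.le hρ hρt hθ
  -- Rüssmann's bound for v - ṽ, whose norm at width ρ is at most E.
  have hsol : ∀ θ ∈ closedStrip n (ρ - δ), ‖solOp ω v θ - solOp ω (dftApprox N v) θ‖ ≤ K * E := by
    intro θ hθ
    rw [← hω.solOp_sub hV hW hδ hδρ hρR hθ]
    exact (hω.norm_solOp_le (hV.sub hW) hδ hδρ hρR L hθ).trans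
      (mul_le_mul_of_nonneg_left (stripNorm_le hρ0.le hdiff) hK0)
  -- Without boundedness the supremum would take the default value 0 and would not dominate the
  -- values.
  have hbdd : ∀ {u : (Fin n → ℂ) → ℂ}, StripAnalytic ρhat u →
      BddAbove ((fun θ => ‖solOp ω u θ‖) '' closedStrip n (ρ - δ)) := by
    rintro u hu
    refine ⟨K * stripNorm ρ u, ?_⟩
    rintro _ ⟨θ, hθ, rfl⟩
    exact hω.norm_solOp_le hu hδ hδρ hρR L hθ
  have hle : ∀ {u : (Fin n → ℂ) → ℂ}, StripAnalytic ρhat u → ∀ θ ∈ closedStrip n (ρ - δ),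
      ‖solOp ω u θ‖ ≤ stripNorm (ρ - δ) (solOp ω u) :=
    fun hu θ hθ => le_csSup (hbdd hu) ⟨θ, hθ, rfl⟩
  have hpos : 0 < stripNorm ρ v := hV.stripNorm_pos hρ0 hρR hne
  have a1 : stripNorm (ρ - δ) (solOp ω (dftApprox N v)) ≤ stripNorm (ρ - δ) (solOp ω v) + K * E :=
    stripNorm_le (sub_nonneg.2 hδρ) fun θ hθ => by
      have := norm_sub_norm_le (solOp ω (dftApprox N v) θ) (solOp ω v θ)
      rw [norm_sub_rev] at this
      linarith [hsol θ hθ, hle hV θ hθ]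
  have a2 : stripNorm (ρ - δ) (solOp ω v) ≤ stripNorm (ρ - δ) (solOp ω (dftApprox N v)) + K * E :=
    stripNorm_le (sub_nonneg.2 hδρ) fun θ hθ => by
      linarith [norm_sub_norm_le (solOp ω v θ) (solOp ω (dftApprox N v) θ), hsol θ hθ,
        hle hW θ hθ]
  have b1 : stripNorm ρ (dftApprox N v) ≤ stripNorm ρ v + E :=
    stripNorm_le hρ0.le fun θ hθ => by
      have := norm_sub_norm_le (dftApprox N v θ) (v θ)
      rw [norm_sub_rev] at this
      linarith [hdiff θ hθ, hV.norm_le_stripNorm hρR hθ]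
  have b2 : stripNorm ρ v ≤ stripNorm ρ (dftApprox N v) + E :=
    stripNorm_le hρ0.le fun θ hθ => by
      linarith [norm_sub_norm_le (v θ) (dftApprox N v θ), hdiff θ hθ,
        hW.norm_le_stripNorm hρR hθ]
  refine ⟨fun θ hθ => hω.summable_solTerm hV hδ hδρ hρR hθ, hbdd hV, hpos, ?_, fun h => ?_⟩
  · rw [hKE, ratioF]
    -- Only the larger quotient needs a nonnegative numerator; the lower endpoint may be negative.
    exact div_le_div₀ (stripNorm_nonneg _ _) (by linarith) hpos b2
  · rw [hKE, ratioF]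
    exact div_le_div₀ ((stripNorm_nonneg _ _).trans a2) a2 h (by linarith)
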